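/- For a finite semigroup $S$ let $S^1$ be $S$ with a neutral element adjoined if necessary, let $\mathcal L,\mathcal R,\mathcal J,\mathcal D$ be Green's relations on $S$, and for $u\in S^1$ let $u^\omega$ be the unique idempotent among the powers $u^n$, $n\ge 1$. We say that $S$ belongs to $\mathbf{DLG}$ if for all $x,y\in S$ and $u,v\in S^1$: (1) if $u^\omega x=x$ and $v^\omega x=x$, then $(uv)^\omega x=x$; (2) if $x\mathrel{\mathcal J}y$, then $u^\omega x=x$ if and only if $u^\omega y=y$; (3) if $ux\mathrel{\mathcal L}x$, then $u^\omega x=x$. We say that $S$ belongs to $\mathbf{DRG}$ if the opposite semigroup $S^{\mathrm{op}}$ belongs to $\mathbf{DLG}$. Let $\Sigma$ (constants) and $\mathcal X$ (variables) be disjoint finite sets and $\Omega=\Sigma\cup\mathcal X$. A word equation is a pair $U=V$ with $U,V\in\Omega^+$; it is quadratic if every variable occurs at most twice in $UV$. A regular constraint in $S$ is a semigroup morphism $\mu\colon\Omega^+\to S$. A solution of $(U=V,\mu)$ is a map $\sigma\colon\mathcal X\to\Sigma^+$ whose extension to a morphism $\sigma\colon\Omega^+\to\Sigma^+$ fixing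 the constants satisfies $\sigma(U)=\sigma(V)$ and $\mu(\sigma(X))=\mu(X)$ for all $X\in\mathcal X$. The exponent of periodicity $\exp(w)$ of a word $w$ is the greatest $n$ with $w=x\,p^n\,y$ for some words $x,p,y$ with $p$ nonempty; $\exp(\sigma)=\max_{X\in\mathcal X}\exp(\sigma(X))$ (which is $0$ if $\mathcal X=\emptyset$), and $\exp(U=V,\mu)\in\mathbb N\cup\{\infty\}$ is the supremum of $\exp(\sigma)$ over all solutions $\sigma$. **Theorem.** Let $S$ be a finite semigroup. (a) $S$ belongs to $\mathbf{DLG}$ if and only if every regular $\mathcal D$-class of $S$ (that is, every $\mathcal D$-class containing an idempotent) is a right group, i.e. is a subsemigroup satisfying the identity $x=y^\omega x$. (b) If $S$ belongs to $\mathbf{DLG}$ or to $\mathbf{DRG}$, then for every quadratic word equation $U=V$ over finite sets of constants and variables and every regular constraint $\mu\colon\Omega^+\to S$, the equation with constraints $(U=V,\mu)$ has infinitely many solutions if and only if $\exp(U=V,\mu)=\infty$. -/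

import Mathlib

universe u v w

/-! ### Finite semigroups: Green's relations, stabilizers, the classes DLG and DRG

`WithOne S` plays the role of `S¹`.  If `S` already has a neutral element, then the additional `1`
acts on `S` exactly as that neutral element does, so that none of the notions below is affected. -/

section Semigroups

variable {S : Type u} [Semigroup S]

/-- `x ≤_L y`, that is, `S¹x ⊆ S¹y`. -/
def GreenLeL (x y : S) : Prop := ∃ s : WithOne S, (x : WithOne S) = s * y

/-- `x ≤_R y`, that is, `xS¹ ⊆ yS¹`. -/
def GreenLeR (x y : S) : Prop := ∃ t : WithOne S, (x : WithOne S) = y * t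

/-- `x ≤_J y`, that is, `S¹xS¹ ⊆ S¹yS¹`. -/
def GreenLeJ (x y : S) : Prop := ∃ s t : WithOne S, (x : WithOne S) = s * y * t

/-- Green's relation `L`. -/
def GreenL (x y : S) : Prop := GreenLeL x y ∧ GreenLeL y x

/-- Green's relation `R`. -/
def GreenR (x y : S) : Prop := GreenLeR x y ∧ GreenLeR y x

/-- Green's relation `J`. -/
def GreenJ (x y : S) : Prop := GreenLeJ x y ∧ GreenLeJ y x

/-- Green's relation `D = L ∘ R`. -/
def GreenD (x y : S) : Prop := ∃ z : S, GreenL x z ∧ GreenR z y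

/-- `u ∈ S¹` is an `L`-stabilizer of `x ∈ S`, that is, `u^ω x = x`, where `u^ω` denotes the
idempotent among the powers of `u` with positive exponent (it exists and is unique if `S` is
finite). -/
def IsLStabilizer (u : WithOne S) (x : S) : Prop :=
  ∃ n : ℕ, 0 < n ∧ IsIdempotentElem (u ^ n) ∧ u ^ n * (x : WithOne S) = x

variable (S)

/-- The class DLG (of finite semigroups), in terms of `L`-stabilizers. -/
structure IsDLG : Prop where
  mul_stab : ∀ (x : S) (u v : WithOne S),
    IsLStabilizer u x → IsLStabilizer v x → IsLStabilizer (u * v) x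
  stab_congr : ∀ (x y : S) (u : WithOne S),
    GreenJ x y → (IsLStabilizer u x ↔ IsLStabilizer u y)
  stab_of_greenL : ∀ (x y : S) (u : WithOne S),
    (y : WithOne S) = u * x → GreenL y x → IsLStabilizer u x

/-- The class DRG, the left-right dual of DLG: the opposite semigroup belongs to DLG. -/
def IsDRG : Prop := IsDLG Sᵐᵒᵖ

/-- A (finite) semigroup is a right group if it satisfies the identity `x = y^ω x`. -/
def IsRightGroup : Prop := ∀ x y : S, IsLStabilizer (y : WithOne S) x

/-- Every regular `D`-class (a `D`-class containing an idempotent `e`) is closed under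
multiplication and is a right group. -/
def RegularDClassesAreRightGroups : Prop :=
  ∀ e : S, IsIdempotentElem e →
    ∃ T : Subsemigroup S, (T : Set S) = {x | GreenD e x} ∧ IsRightGroup T

end Semigroups

/-! ### Words and the exponent of periodicity -/

section Words

variable {A : Type v}

/-- The inclusion of the free semigroup `A⁺` into the free monoid `A*`. -/
def toFreeMonoid : FreeSemigroup A →ₙ* FreeMonoid A := FreeSemigroup.lift FreeMonoid.of

/-- The exponents `n` of the powers `pⁿ` of nonempty words `p` that are factors of `w`. -/
def powerExponents (w : FreeMonoid A) : Set ℕ :=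
  {n | ∃ x p y : FreeMonoid A, p ≠ 1 ∧ w = x * p ^ n * y}

/-- The exponent of periodicity of a word: the greatest `n` such that `w = x pⁿ y` for some
words `x, p, y` with `p` nonempty. -/
noncomputable def wordExp (w : FreeMonoid A) : ℕ := sSup (powerExponents w)

theorem le_length_of_mem_powerExponents {w : FreeMonoid A} {n : ℕ} (hn : n ∈ powerExponents w) :
    n ≤ w.length := by
  obtain ⟨x, p, y, hp, rfl⟩ := hn
  have h1 : 1 ≤ p.length := by
    by_contra h
    exact hp (FreeMonoid.length_eq_zero.mp (by omega))
  have h2 : ∀ k : ℕ, k ≤ (p ^ k).length := by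
    intro k
    induction k with
    | zero => simp
    | succ k ih => rw [pow_succ, FreeMonoid.length_mul]; omega
  have := h2 n
  rw [FreeMonoid.length_mul, FreeMonoid.length_mul]
  omega

/-- For a nonempty word the supremum defining the exponent of periodicity is a maximum. -/
theorem isGreatest_wordExp (w : FreeSemigroup A) :
    IsGreatest (powerExponents (toFreeMonoid w)) (wordExp (toFreeMonoid w)) := by
  have hbdd : BddAbove (powerExponents (toFreeMonoid w)) :=
    ⟨_, fun _ hn => le_length_of_mem_powerExponents hn⟩
  refine ⟨Nat.sSup_mem ⟨0, 1, FreeMonoid.of w.head, toFreeMonoid w, ?_, by simp⟩ hbdd,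
    fun n hn => le_csSup hbdd hn⟩
  exact FreeMonoid.of_ne_one _

end Words

/-! ### Word equations with regular constraints over free semigroups -/

/-- A word equation `U = V` over `Ω⁺`, where `Ω` is the disjoint union of the alphabet of
constants `A` and the set of variables `X`. -/
structure WordEquation (A : Type v) (X : Type w) where
  lhs : FreeSemigroup (A ⊕ X)
  rhs : FreeSemigroup (A ⊕ X)

section WordEquations

variable {S : Type u} [Semigroup S] {A : Type v} {X : Type w}

/-- The extension of `σ : X → A⁺` to a morphism `Ω⁺ → A⁺` leaving the constants invariant. -/
def extendSubst (σ : X → FreeSemigroup A) : FreeSemigroup (A ⊕ X) →ₙ* FreeSemigroup A :=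
  FreeSemigroup.lift (Sum.elim FreeSemigroup.of σ)

/-- The exponent of periodicity of `σ`: the maximum of the exponents of periodicity of the words
`σ(Z)`, where `Z` ranges over all variables (`0` if there are no variables). -/
noncomputable def substExp [Fintype X] (σ : X → FreeSemigroup A) : ℕ :=
  Finset.univ.sup fun Z => wordExp (toFreeMonoid (σ Z))

namespace WordEquation

open Classical in
/-- The equation is quadratic: every variable occurs at most twice in `UV`. -/
def IsQuadratic (E : WordEquation A X) : Prop :=
  ∀ Z : X, (toFreeMonoid (E.lhs * E.rhs)).toList.countP (fun c => c = Sum.inr Z) ≤ 2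

/-- The solutions of `E` with the regular constraint `μ : Ω⁺ → S`: all `σ : X → A⁺` with
`σ(U) = σ(V)` and `μ(σ(Z)) = μ(Z)` for every variable `Z`. -/
def Sol (E : WordEquation A X) (μ : FreeSemigroup (A ⊕ X) →ₙ* S) : Set (X → FreeSemigroup A) :=
  {σ | extendSubst σ E.lhs = extendSubst σ E.rhs ∧
    ∀ Z : X, μ (FreeSemigroup.map Sum.inl (σ Z)) = μ (FreeSemigroup.of (Sum.inr Z))}

/-- The exponent of periodicity of an equation with constraints, the supremum of the exponents of
periodicity of its solutions in `ℕ ∪ {∞}`. -/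
noncomputable def exp [Fintype X] (E : WordEquation A X) (μ : FreeSemigroup (A ⊕ X) →ₙ* S) : ℕ∞ :=
  ⨆ σ ∈ E.Sol μ, (substExp σ : ℕ∞)

end WordEquation

end WordEquations

/-! Call u a left stabilizer of x if ux is L-equivalent to x.

Part (a) turns on the L-classes of idempotents. In a right group, an element z that is L-equivalent
to an idempotent h satisfies hz = z, and some power of z fixes h. Finiteness extends this to all x:
if s(ax) = x, a power of sa is an idempotent fixing x, and one can work below that idempotent
(`IdempotentLClassesPeriodic.exists_pow`, `idempotent_mul_eq`). Conversely, an idempotent stabilizes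
itself, hence by J-invariance everything in its D-class, which forces the right group law.

In part (b), finitely many solutions have bounded exponents. For the other direction, suppose some
quadratic equation has infinitely many solutions but bounded powers, and take a shortest one. Its
sides begin with distinct letters, and infinitely many solutions give one of them, a variable x, an
image at least as long as that of the other, y. Substituting yx for x and cancelling y keeps
infinitely many solutions for some new constraint on x. Quadraticity prevents the length from
growing and minimality prevents it from shrinking, so such moves continue forever.

The constraint of the winner x can only rise in the L-order, so on a tail of the path all L-classes
are constant. There the loser y stabilizes the constraint of x. As each winner next wins again or
loses, and stabilization is transitive, every loser stabilizes every winner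
(`RecurrentPath.lStab_loser`). Counting occurrences gives a moment when the equation reads xs = axb
with x a winner (`exists_mem_both_sides`), and every letter of a is later cancelled, hence is a
loser (`exists_loser_eq`). So the value of a acts periodically on the constraint of x, and σ(x) may
be preceded by arbitrarily high powers of σ(a) (`unboundedPowers_of_lStab`), a contradiction. DRG
follows by reading words backwards. -/

/-! ### Left stabilizers in finite monoids -/

section LeftStabilizers

variable {M : Type u} [Monoid M]

/-- `u * x` is `L`-equivalent to `x`. -/
def LStab (u x : M) : Prop := ∃ s, s * (u * x) = x

/-- The monoid form of the class DLG: left stabilizers act periodically, and they depend only on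
the `L`-class of the stabilized element. -/
structure LStabilizing (M : Type u) [Monoid M] : Prop where
  exists_pow : ∀ u x : M, LStab u x → ∃ n, 0 < n ∧ u ^ n * x = x
  congr : ∀ u x s t : M, t * (s * x) = x → LStab u x → LStab u (s * x)

/-- The elements of the `L`-class of an idempotent `h` are stabilized by `h` and act
periodically on `h`. -/
def IdempotentLClassesPeriodic (M : Type u) [Monoid M] : Prop :=
  ∀ h z s t : M, h * h = h → s * z = h → t * h = z →
    h * z = z ∧ ∃ n, 0 < n ∧ z ^ n * h = h

theorem exists_isIdempotentElem_pow [Finite M] (a : M) :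
    ∃ n, 0 < n ∧ IsIdempotentElem (a ^ n) := by
  obtain ⟨i, j, hij, h⟩ : ∃ i j : ℕ, i < j ∧ a ^ (i + 1) = a ^ (j + 1) := by
    obtain ⟨i, j, hne, h⟩ := Finite.exists_ne_map_eq_of_infinite fun n : ℕ => a ^ (n + 1)
    rcases lt_or_gt_of_ne hne with hl | hl
    · exact ⟨i, j, hl, h⟩
    · exact ⟨j, i, hl, h.symm⟩
  obtain ⟨d, rfl⟩ := Nat.exists_eq_add_of_lt hij
  have hstep : ∀ k, a ^ (i + 1 + k + (d + 1)) = a ^ (i + 1 + k) := by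
    intro k
    rw [pow_add a (i + 1) k, h, ← pow_add]
    congr 1
    ring
  have hmul : ∀ m k, a ^ (i + 1 + k + m * (d + 1)) = a ^ (i + 1 + k) := by
    intro m k
    induction m with
    | zero => simp
    | succ m ih =>
      rw [← ih, add_assoc (i + 1) k (m * (d + 1)), ← hstep (k + m * (d + 1))]
      congr 1
      ring
  refine ⟨(i + 1) * (d + 1), by positivity, ?_⟩
  have := hmul (i + 1) ((i + 1) * d)
  rw [IsIdempotentElem, ← pow_add]
  convert this using 2 <;> ring

theorem pow_mul_eq_self {u x : M} (h : u * x = x) (n : ℕ) : u ^ n * x = x := by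
  induction n with
  | zero => simp
  | succ n ih => rw [pow_succ, mul_assoc, h, ih]

theorem LStab.of_pow {u x : M} {n : ℕ} (hn : 0 < n) (h : u ^ n * x = x) : LStab u x := by
  obtain ⟨k, rfl⟩ := Nat.exists_eq_add_of_lt hn
  exact ⟨u ^ (0 + k), by rw [← mul_assoc, ← pow_succ, h]⟩

theorem LStab.of_eq_mul {u u' b x : M} (h : u = b * u') (hu : LStab u x) : LStab u' x := by
  obtain ⟨s, hs⟩ := hu
  exact ⟨s * b, by rw [h] at hs; simpa [mul_assoc] using hs⟩

theorem LStab.one (x : M) : LStab 1 x := ⟨1, by simp⟩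

namespace LStabilizing

variable (hM : LStabilizing M)
include hM

theorem mul {a b x : M} (ha : LStab a x) (hb : LStab b x) : LStab (a * b) x := by
  obtain ⟨t, ht⟩ := hb
  obtain ⟨s, hs⟩ := hM.congr a x b t ht ha
  exact ⟨t * s, by rw [mul_assoc a b x, mul_assoc t s, hs, ht]⟩

theorem list_prod {l : List M} {x : M} (h : ∀ a ∈ l, LStab a x) : LStab l.prod x := by
  induction l with
  | nil => exact LStab.one x
  | cons a l ih =>
    rw [List.prod_cons]
    exact hM.mul (h a (by simp)) (ih fun b hb => h b (by simp [hb]))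

/-- Since x equals bⁿx with n positive, a acts on x through its action on the leftmost factor b,
where it can be undone. -/
theorem trans {a b x : M} (hab : LStab a b) (hb : LStab b x) : LStab a x := by
  obtain ⟨s, hs⟩ := hab
  obtain ⟨n, hn, hx⟩ := hM.exists_pow b x hb
  obtain ⟨k, rfl⟩ := Nat.exists_eq_add_of_lt hn
  refine ⟨s, ?_⟩
  rw [← hx, pow_succ']
  simp only [← mul_assoc]
  rw [mul_assoc s a b, hs]

theorem of_mulEquiv {N : Type v} [Monoid N] (f : M ≃* N) : LStabilizing N := by
  have key : ∀ a x : N, LStab a x ↔ LStab (f.symm a) (f.symm x) := by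
    intro a x
    constructor
    · rintro ⟨s, hs⟩
      exact ⟨f.symm s, by rw [← map_mul, ← map_mul, hs]⟩
    · rintro ⟨s, hs⟩
      exact ⟨f s, by apply f.symm.injective; simpa using hs⟩
  refine ⟨fun a x h => ?_, fun a x s t h hx => ?_⟩
  · obtain ⟨n, hn, hx⟩ := hM.exists_pow _ _ ((key a x).1 h)
    exact ⟨n, hn, by apply f.symm.injective; simpa using hx⟩
  · rw [key, map_mul]
    refine hM.congr _ _ _ (f.symm t) ?_ ((key a x).1 hx)
    rw [← map_mul, ← map_mul, h]

end LStabilizing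

/-! ### From the L-classes of idempotents to arbitrary L-classes -/

namespace IdempotentLClassesPeriodic

variable [Finite M] (hM : IdempotentLClassesPeriodic M)
include hM

/-- An idempotent power e of sa fixes x, and ae is L-equivalent to e. Hence e(ae) = ae, so the
powers of ae are aʲe, and periodicity on e passes to x = ex. -/
theorem exists_pow {a x : M} (h : LStab a x) : ∃ n, 0 < n ∧ a ^ n * x = x := by
  obtain ⟨s, hs⟩ := h
  obtain ⟨n, hn, he⟩ := exists_isIdempotentElem_pow (s * a)
  have hex : (s * a) ^ n * x = x := pow_mul_eq_self (by rw [mul_assoc, hs]) n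
  obtain ⟨k, rfl⟩ := Nat.exists_eq_add_of_lt hn
  set e := (s * a) ^ (0 + k + 1) with hedef
  have h1 : (s * a) ^ (0 + k) * s * (a * e) = e := by
    rw [← mul_assoc, mul_assoc _ s a, ← pow_succ]
    exact he
  obtain ⟨hez, m, hm, hz⟩ := hM e (a * e) _ a he h1 rfl
  have hpow : ∀ j, (a * e) ^ (j + 1) = a ^ (j + 1) * e := by
    intro j
    induction j with
    | zero => simp
    | succ j ih => rw [pow_succ, ih, mul_assoc, hez, ← mul_assoc, ← pow_succ]
  obtain ⟨j, rfl⟩ := Nat.exists_eq_add_of_lt hm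
  rw [hpow, mul_assoc, he.eq] at hz
  exact ⟨_, hm, by rw [← hex, ← mul_assoc, hz]⟩

/-- With sᵐx = x, an idempotent power h of esᵐ fixes x, starts with e and ends with s. Thus eh = h
and sh is L-equivalent to h, so that sh = hsh absorbs e on the left. -/
theorem idempotent_mul_eq {e x s a : M} (he : e * e = e) (hx : e * x = x)
    (ha : a * (s * x) = x) : e * (s * x) = s * x := by
  obtain ⟨m, hm, hsx⟩ := hM.exists_pow ⟨a, ha⟩
  obtain ⟨m, rfl⟩ := Nat.exists_eq_add_of_lt hm
  obtain ⟨k, hk, hh⟩ := exists_isIdempotentElem_pow (e * s ^ (0 + m + 1))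
  have hhx : (e * s ^ (0 + m + 1)) ^ k * x = x :=
    pow_mul_eq_self (by rw [mul_assoc, hsx, hx]) k
  obtain ⟨k, rfl⟩ := Nat.exists_eq_add_of_lt hk
  set h := (e * s ^ (0 + m + 1)) ^ (0 + k + 1) with hdef
  have heh : e * h = h := by
    rw [hdef, pow_succ', ← mul_assoc, ← mul_assoc, he]
  have hL : (e * s ^ (0 + m + 1)) ^ (0 + k) * e * s ^ (0 + m) * (s * h) = h := by
    conv_rhs => rw [← hh.eq]
    conv_rhs => enter [1]; rw [hdef, pow_succ]
    conv_rhs => enter [1, 2]; rw [pow_succ]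
    simp only [mul_assoc]
  have hsh := (hM h (s * h) _ s hh hL rfl).1
  have : e * (s * h) = s * h := by
    rw [← hsh, ← mul_assoc, heh]
  rw [← hhx, ← mul_assoc s, ← mul_assoc, this]

/-- By finiteness, J-equivalence of x and sxt already makes sx L-equivalent to x. The previous case
gives the claim for sx, and the factor t on the right is harmless. -/
theorem idempotent_mul_eq_of_greenJ {e x s t s' t' : M} (he : e * e = e) (hx : e * x = x)
    (h : s' * (s * x * t) * t' = x) : e * (s * x * t) = s * x * t := by
  obtain ⟨k, hk, hf⟩ := exists_isIdempotentElem_pow (s' * s)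
  have hpow : ∀ j, (s' * s) ^ j * x * (t * t') ^ j = x := by
    intro j
    induction j with
    | zero => simp
    | succ j ih =>
      rw [pow_succ, pow_succ']
      have : s' * s * x * (t * t') = x := by simpa [mul_assoc] using h
      calc (s' * s) ^ j * (s' * s) * x * (t * t' * (t * t') ^ j)
          = (s' * s) ^ j * (s' * s * x * (t * t')) * (t * t') ^ j := by simp only [mul_assoc]
        _ = x := by rw [this, ih]
  have hfx : (s' * s) ^ k * x = x := by
    conv_lhs => rw [← hpow k]
    rw [← mul_assoc, ← mul_assoc, hf.eq, hpow]
  obtain ⟨k, rfl⟩ := Nat.exists_eq_add_of_lt hk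
  have : (s' * s) ^ (0 + k) * s' * (s * x) = x := by
    rw [pow_succ] at hfx
    simpa [mul_assoc] using hfx
  rw [← mul_assoc, hM.idempotent_mul_eq he hx this]

theorem lStabilizing : LStabilizing M := by
  refine ⟨fun a x => hM.exists_pow, fun a x s t h hx => ?_⟩
  obtain ⟨n, hn, hax⟩ := hM.exists_pow hx
  obtain ⟨k, hk, hi⟩ := exists_isIdempotentElem_pow (a ^ n)
  rw [← pow_mul] at hi
  refine LStab.of_pow (Nat.mul_pos hn hk) (hM.idempotent_mul_eq hi.eq ?_ h)
  rw [pow_mul]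
  exact pow_mul_eq_self hax k

end IdempotentLClassesPeriodic

end LeftStabilizers

/-! ### The class DLG -/

section DLG

variable {S : Type u} [Semigroup S]

theorem WithOne.eq_one_of_mul_eq_one {a b : WithOne S} (h : a * b = 1) : a = 1 ∧ b = 1 := by
  induction a using WithOne.recOneCoe with
  | one => simpa using h
  | coe a =>
    induction b using WithOne.recOneCoe with
    | one => simp at h
    | coe b => exact absurd h WithOne.coe_ne_one

theorem WithOne.exists_coe_eq_mul_coe (a : WithOne S) (x : S) :
    ∃ y : S, (y : WithOne S) = a * x :=
  WithOne.ne_one_iff_exists.1 fun h => WithOne.coe_ne_one (WithOne.eq_one_of_mul_eq_one h).2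

theorem isLStabilizer_iff [Finite S] {a : WithOne S} {x : S} :
    IsLStabilizer a x ↔ ∃ n, 0 < n ∧ a ^ n * (x : WithOne S) = x := by
  have : Finite (WithOne S) := inferInstanceAs (Finite (Option S))
  constructor
  · rintro ⟨n, hn, -, h⟩
    exact ⟨n, hn, h⟩
  · rintro ⟨n, hn, h⟩
    obtain ⟨k, hk, hi⟩ := exists_isIdempotentElem_pow (a ^ n)
    exact ⟨n * k, Nat.mul_pos hn hk, by rwa [pow_mul], by rw [pow_mul, pow_mul_eq_self h]⟩

theorem IsDLG.lStabilizing [Finite S] (hS : IsDLG S) : LStabilizing (WithOne S) := by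
  have hpow : ∀ (a : WithOne S) (x : S), LStab a (x : WithOne S) → IsLStabilizer a x := by
    rintro a x ⟨s, hs⟩
    obtain ⟨y, hy⟩ := WithOne.exists_coe_eq_mul_coe a x
    exact hS.stab_of_greenL x y a hy ⟨⟨a, hy⟩, s, by rw [hy, hs]⟩
  constructor
  · rintro a x h
    induction x using WithOne.recOneCoe with
    | one =>
      obtain ⟨s, hs⟩ := h
      rw [mul_one] at hs
      exact ⟨1, one_pos, by simpa using (WithOne.eq_one_of_mul_eq_one hs).2⟩
    | coe x => exact isLStabilizer_iff.1 (hpow a x h)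
  · intro a x s t h hx
    induction x using WithOne.recOneCoe with
    | one =>
      rw [mul_one] at h
      rwa [(WithOne.eq_one_of_mul_eq_one h).2, one_mul]
    | coe x =>
      obtain ⟨y, hy⟩ := WithOne.exists_coe_eq_mul_coe s x
      have hJ : GreenJ x y := ⟨⟨t, 1, by rw [hy, mul_one, h]⟩, s, 1, by rw [hy, mul_one]⟩
      obtain ⟨n, hn, -, hy'⟩ := (hS.stab_congr x y a hJ).1 (hpow a x hx)
      rw [← hy]
      exact LStab.of_pow hn hy'

theorem IsDLG.of_idempotentLClassesPeriodic [Finite S]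
    (hM : IdempotentLClassesPeriodic (WithOne S)) : IsDLG S := by
  have : Finite (WithOne S) := inferInstanceAs (Finite (Option S))
  have hL := hM.lStabilizing
  have hstab : ∀ (a : WithOne S) (x : S), LStab a (x : WithOne S) ↔ IsLStabilizer a x :=
    fun a x => ⟨fun h => isLStabilizer_iff.2 (hM.exists_pow h),
      fun ⟨n, hn, _, h⟩ => LStab.of_pow hn h⟩
  have hJ : ∀ (x y : S) (a : WithOne S), GreenJ x y → IsLStabilizer a x →
      IsLStabilizer a y := by
    rintro x y a ⟨⟨s', t', hx⟩, s, t, hy⟩ ⟨n, hn, hi, h⟩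
    refine ⟨n, hn, hi, ?_⟩
    rw [hy]
    exact hM.idempotent_mul_eq_of_greenJ hi h (by rw [← hy, ← hx])
  refine ⟨fun x a b ha hb => ?_, fun x y a h => ⟨hJ x y a h, hJ y x a h.symm⟩, ?_⟩
  · rw [← hstab] at *
    exact hL.mul ha hb
  · rintro x y a hy ⟨-, s, hs⟩
    rw [← hstab]
    exact ⟨s, by rw [← hy, hs]⟩

/-! ### Regular D-classes and right groups -/

theorem GreenLeL.refl (x : S) : GreenLeL x x := ⟨1, by simp⟩

theorem GreenLeR.refl (x : S) : GreenLeR x x := ⟨1, by simp⟩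

theorem GreenLeL.trans {x y z : S} (h : GreenLeL x y) (h' : GreenLeL y z) : GreenLeL x z := by
  obtain ⟨s, hs⟩ := h
  obtain ⟨t, ht⟩ := h'
  exact ⟨s * t, by rw [hs, ht, mul_assoc]⟩

theorem GreenLeR.mul_left {x y : S} (h : GreenLeR x y) (a : S) : GreenLeR (a * x) (a * y) := by
  obtain ⟨t, ht⟩ := h
  exact ⟨t, by rw [WithOne.coe_mul, WithOne.coe_mul, ht, mul_assoc]⟩

theorem GreenD.greenJ {x y : S} (h : GreenD x y) : GreenJ x y := by
  obtain ⟨z, ⟨⟨a, ha⟩, b, hb⟩, ⟨c, hc⟩, d, hd⟩ := h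
  exact ⟨⟨a, c, by rw [ha, hc, mul_assoc]⟩, b, d, by rw [hd, hb]⟩

theorem RegularDClassesAreRightGroups.idempotentLClassesPeriodic
    (hS : RegularDClassesAreRightGroups S) : IdempotentLClassesPeriodic (WithOne S) := by
  intro h z s t hh hs ht
  induction h using WithOne.recOneCoe with
  | one =>
    rw [(WithOne.eq_one_of_mul_eq_one hs).2]
    exact ⟨by simp, 1, by simp⟩
  | coe e =>
    obtain ⟨z', hz'⟩ := WithOne.exists_coe_eq_mul_coe t e
    rw [ht] at hz'
    subst hz'
    have he : IsIdempotentElem e := WithOne.coe_inj.1 (by simpa using hh)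
    obtain ⟨T, hT, hr⟩ := hS e he
    have heT : e ∈ T := by
      rw [← SetLike.mem_coe, hT]
      exact ⟨e, ⟨GreenLeL.refl e, GreenLeL.refl e⟩, GreenLeR.refl e, GreenLeR.refl e⟩
    have hzT : z' ∈ T := by
      rw [← SetLike.mem_coe, hT]
      exact ⟨z', ⟨⟨s, hs.symm⟩, t, ht.symm⟩, GreenLeR.refl _, GreenLeR.refl _⟩
    have key : ∀ x y : T, ∃ n, 0 < n ∧ ((y : S) : WithOne S) ^ n * (x : S) = (x : S) := by
      intro x y
      obtain ⟨n, hn, -, h⟩ := hr x y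
      refine ⟨n, hn, ?_⟩
      have := congrArg (WithOne.mapMulHom (MulMemClass.subtype T)) h
      simpa using this
    refine ⟨?_, key ⟨e, heT⟩ ⟨z', hzT⟩⟩
    obtain ⟨n, hn, h⟩ := key ⟨z', hzT⟩ ⟨e, heT⟩
    conv_rhs => rw [← h]
    obtain ⟨k, rfl⟩ := Nat.exists_eq_add_of_lt hn
    have hi : IsIdempotentElem ((e : S) : WithOne S) := hh
    rw [hi.pow_succ_eq]

theorem IsDLG.regularDClassesAreRightGroups [Finite S] (hS : IsDLG S) :
    RegularDClassesAreRightGroups S := by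
  have hL := hS.lStabilizing
  intro e he
  have hid : ∀ g x : S, IsIdempotentElem g → GreenJ g x → g * x = x := by
    intro g x hg hJ
    have hg' : IsIdempotentElem (g : WithOne S) := by
      rw [IsIdempotentElem, ← WithOne.coe_mul, hg.eq]
    obtain ⟨n, hn, -, h⟩ := (hS.stab_congr g x g hJ).1 ⟨1, one_pos, by simpa using hg', by
      rw [pow_one]; exact hg'⟩
    obtain ⟨k, rfl⟩ := Nat.exists_eq_add_of_lt hn
    rw [hg'.pow_succ_eq, ← WithOne.coe_mul] at h
    exact WithOne.coe_inj.1 h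
  have key : ∀ x y : S, GreenD e x → GreenD e y → LStab (y : WithOne S) (x : WithOne S) := by
    intro x y hx hy
    have hJx := hx.greenJ
    have hJy := hy.greenJ
    obtain ⟨z, ⟨⟨s, hs⟩, p, hp⟩, ⟨t, ht⟩, q, hq⟩ := hy
    have he' : (e : WithOne S) * e = e := by rw [← WithOne.coe_mul, he.eq]
    -- In the D-class of an idempotent y is regular. Then g = tsy is an idempotent J-equivalent to
    -- x, so gx = x, which says that ts undoes the action of y on x.
    have hyy : (y : WithOne S) = y * (t * s * y) := by
      have hz : (z : WithOne S) = z * (s * z) := by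
        rw [← hs, hp, mul_assoc, he']
      calc (y : WithOne S) = z * (s * z) * q := by rw [← hz, hq]
        _ = z * (s * y) := by rw [hq]; simp only [mul_assoc]
        _ = y * (t * s * y) := by rw [ht]; simp only [mul_assoc]
    obtain ⟨g, hg⟩ := WithOne.exists_coe_eq_mul_coe (t * s) y
    have hgi : IsIdempotentElem g := by
      apply WithOne.coe_inj.1
      rw [WithOne.coe_mul, hg, mul_assoc, ← hyy]
    have hyg : GreenJ g y := ⟨⟨t * s, 1, by rw [hg, mul_one]⟩, y, 1, by rw [hg, mul_one, ← hyy]⟩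
    have hJ : GreenJ g x := by
      obtain ⟨⟨a₁, b₁, h₁⟩, a₂, b₂, h₂⟩ := hyg
      obtain ⟨⟨a₃, b₃, h₃⟩, a₄, b₄, h₄⟩ := hJy
      obtain ⟨⟨a₅, b₅, h₅⟩, a₆, b₆, h₆⟩ := hJx
      exact ⟨⟨a₁ * a₄ * a₅, b₅ * b₄ * b₁, by rw [h₁, h₄, h₅]; simp only [mul_assoc]⟩,
        a₆ * a₃ * a₂, b₂ * b₃ * b₆, by rw [h₆, h₃, h₂]; simp only [mul_assoc]⟩
    have := hid g x hgi hJ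
    refine ⟨t * s, ?_⟩
    rw [← mul_assoc, ← hg, ← WithOne.coe_mul, this]
  have hmul : ∀ x y : S, GreenD e x → GreenD e y → GreenD e (y * x) := by
    rintro x y ⟨z, ⟨hez, hze⟩, hzx, hxz⟩ hy
    obtain ⟨a, ha⟩ := key z y ⟨z, ⟨hez, hze⟩, GreenLeR.refl z, GreenLeR.refl z⟩ hy
    refine ⟨y * z, ⟨hez.trans ⟨a, ?_⟩, GreenLeL.trans ⟨y, ?_⟩ hze⟩, hzx.mul_left y, hxz.mul_left y⟩
    · rw [WithOne.coe_mul, ha]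
    · rw [WithOne.coe_mul]
  refine ⟨⟨{x | GreenD e x}, fun hy hx => hmul _ _ hx hy⟩, rfl, ?_⟩
  rintro ⟨x, hx⟩ ⟨y, hy⟩
  rw [isLStabilizer_iff]
  obtain ⟨n, hn, h⟩ := hL.exists_pow _ _ (key x y hx hy)
  refine ⟨n, hn, WithOne.mapMulHom_injective
    (MulMemClass.subtype_injective (S' := (⟨{x | GreenD e x}, fun hy hx => hmul _ _ hx hy⟩ :
      Subsemigroup S))) ?_⟩
  simpa using h

theorem isDLG_iff_regularDClassesAreRightGroups [Finite S] :
    IsDLG S ↔ RegularDClassesAreRightGroups S :=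
  ⟨IsDLG.regularDClassesAreRightGroups,
    fun h => IsDLG.of_idempotentLClassesPeriodic h.idempotentLClassesPeriodic⟩

/-- Adjoining a neutral element commutes with passing to the opposite semigroup. -/
def WithOne.opEquiv (S : Type u) [Semigroup S] : WithOne Sᵐᵒᵖ ≃* (WithOne S)ᵐᵒᵖ where
  toFun := WithOne.recOneCoe 1 fun s => MulOpposite.op (s.unop : WithOne S)
  invFun a := WithOne.recOneCoe 1 (fun s => ((MulOpposite.op s : Sᵐᵒᵖ) : WithOne Sᵐᵒᵖ)) a.unop
  left_inv a := by induction a using WithOne.recOneCoe <;> rfl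
  right_inv a := by
    induction a using MulOpposite.rec' with
    | _ a => induction a using WithOne.recOneCoe <;> rfl
  map_mul' a b := by
    induction a using WithOne.recOneCoe with
    | one => simp
    | coe a =>
      induction b using WithOne.recOneCoe with
      | one => simp
      | coe b => rfl

theorem IsDRG.lStabilizing [Finite S] (hS : IsDRG S) : LStabilizing (WithOne S)ᵐᵒᵖ :=
  have : Finite Sᵐᵒᵖ := Finite.of_equiv S MulOpposite.opEquiv
  (IsDLG.lStabilizing hS).of_mulEquiv (WithOne.opEquiv S)

end DLG

/-! ### Word equations over free monoids with constraints in a monoid -/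

section EquationStates

variable {A : Type v} {X : Type w} {M : Type u}

/-- The image of a letter under the morphism defined by `σ` that fixes the constants. -/
def letterSubst (σ : X → List A) : A ⊕ X → List A := Sum.elim (fun a => [a]) σ

/-- The image of a word under the morphism defined by `σ` that fixes the constants. -/
def wordSubst (σ : X → List A) (l : List (A ⊕ X)) : List A := l.flatMap (letterSubst σ)

@[simp]
theorem wordSubst_nil (σ : X → List A) : wordSubst σ [] = [] := rfl

@[simp]
theorem wordSubst_cons (σ : X → List A) (z : A ⊕ X) (l : List (A ⊕ X)) :
    wordSubst σ (z :: l) = letterSubst σ z ++ wordSubst σ l := rfl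

@[simp]
theorem wordSubst_append (σ : X → List A) (l l' : List (A ⊕ X)) :
    wordSubst σ (l ++ l') = wordSubst σ l ++ wordSubst σ l' := List.flatMap_append

/-- `l` contains the `n`-th power of a nonempty word as a factor. -/
def HasPower (n : ℕ) (l : List A) : Prop := ∃ p ≠ [], (List.replicate n p).flatten <:+: l

theorem HasPower.of_isInfix {n : ℕ} {l l' : List A} (h : HasPower n l) (hl : l <:+: l') :
    HasPower n l' := by
  obtain ⟨p, hp, h⟩ := h
  exact ⟨p, hp, h.trans hl⟩

theorem HasPower.mono {m n : ℕ} (hmn : m ≤ n) {l : List A} (h : HasPower n l) :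
    HasPower m l := by
  obtain ⟨p, hp, h⟩ := h
  obtain ⟨k, rfl⟩ := Nat.exists_eq_add_of_le hmn
  refine ⟨p, hp, List.IsInfix.trans ⟨[], (List.replicate k p).flatten, ?_⟩ h⟩
  rw [List.replicate_add, List.flatten_append, List.nil_append]

/-- An equation between words over constants `A` and variables `X`, with a prescribed value in
`M` for every variable. Variables may be replaced by the empty word. -/
structure EqState (A : Type v) (X : Type w) (M : Type u) where
  lhs : List (A ⊕ X)
  rhs : List (A ⊕ X)
  con : X → M

section Values

variable [Monoid M] (c : A → M)

/-- The value of a word over the constants. -/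
def wordVal (l : List A) : M := (l.map c).prod

@[simp]
theorem wordVal_nil : wordVal c [] = 1 := rfl

@[simp]
theorem wordVal_append (l l' : List A) : wordVal c (l ++ l') = wordVal c l * wordVal c l' := by
  simp [wordVal]

theorem wordVal_flatten_replicate (n : ℕ) (l : List A) :
    wordVal c (List.replicate n l).flatten = wordVal c l ^ n := by
  induction n with
  | zero => simp
  | succ n ih => rw [List.replicate_succ, List.flatten_cons, wordVal_append, ih, pow_succ']

namespace EqState

variable (E : EqState A X M)

/-- The value of a letter. -/
def letterVal : A ⊕ X → M := Sum.elim c E.con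

/-- The solutions of the equation satisfying the constraints. -/
def sol : Set (X → List A) :=
  {σ | wordSubst σ E.lhs = wordSubst σ E.rhs ∧ ∀ Z, wordVal c (σ Z) = E.con Z}

/-- The solutions contain arbitrarily high powers of nonempty words. -/
def UnboundedPowers : Prop := ∀ n, ∃ σ ∈ E.sol c, ∃ Z, HasPower n (σ Z)

/-- The equation with both sides interchanged. -/
def swap : EqState A X M := ⟨E.rhs, E.lhs, E.con⟩

theorem swap_sol : E.swap.sol c = E.sol c := by
  ext σ
  simp [sol, swap, eq_comm]

variable {c E}

theorem wordVal_letterSubst {σ : X → List A} (hσ : ∀ Z, wordVal c (σ Z) = E.con Z)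
    (z : A ⊕ X) : wordVal c (letterSubst σ z) = E.letterVal c z := by
  cases z with
  | inl a => simp [wordVal, letterSubst, letterVal]
  | inr Z => exact hσ Z

theorem wordVal_wordSubst {σ : X → List A} (hσ : ∀ Z, wordVal c (σ Z) = E.con Z)
    (l : List (A ⊕ X)) : wordVal c (wordSubst σ l) = (l.map (E.letterVal c)).prod := by
  induction l with
  | nil => simp
  | cons z l ih => simp [ih, wordVal_letterSubst hσ]

theorem letterSubst_ne_nil {σ : X → List A} (hσ : ∀ Z, wordVal c (σ Z) = E.con Z)
    {z : A ⊕ X} (hz : E.letterVal c z ≠ 1) : letterSubst σ z ≠ [] := by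
  intro h
  rw [← wordVal_letterSubst hσ, h, wordVal_nil] at hz
  exact hz rfl

theorem exists_wordVal_infinite [Finite X] (h : (E.sol c).Infinite) :
    ∃ Z, {l | wordVal c l = E.con Z}.Infinite := by
  by_contra! hfin
  exact h ((Set.Finite.pi' hfin).subset fun σ hσ Z => hσ.2 Z)

/-- Pigeonhole on prefixes: a word longer than the size of M has two prefixes of equal value, and
the segment between them can be repeated. -/
theorem exists_pump [Finite A] [Finite M] {s : M} (h : {l | wordVal c l = s}.Infinite) :
    ∃ a p b, p ≠ [] ∧ ∀ n, wordVal c (a ++ (List.replicate n p).flatten ++ b) = s := by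
  obtain ⟨l, hl, hlen⟩ := h.exists_notMem_finite (List.finite_length_le A (Nat.card M))
  simp only [Set.mem_ofPred_eq, not_le] at hl hlen
  obtain ⟨i, j, hij, hj, hv⟩ : ∃ i j, i < j ∧ j ≤ l.length ∧
      wordVal c (l.take i) = wordVal c (l.take j) := by
    have : ¬ Function.Injective fun i : Fin (Nat.card M + 1) => wordVal c (l.take i) := by
      intro hi
      have := Nat.card_le_card_of_injective _ hi
      simp at this
    simp only [Function.Injective, not_forall] at this
    obtain ⟨i, j, hv, hne⟩ := this
    rcases lt_or_gt_of_ne hne with hlt | hlt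
    · exact ⟨i, j, hlt, by omega, hv⟩
    · exact ⟨j, i, hlt, by omega, hv.symm⟩
  have htake : l.take j = l.take i ++ (l.take j).drop i := by
    conv_lhs => rw [← List.take_append_drop i (l.take j)]
    rw [List.take_take, min_eq_left hij.le]
  have hmul : wordVal c (l.take i) * wordVal c ((l.take j).drop i) = wordVal c (l.take i) := by
    rw [← wordVal_append, ← htake, hv]
  have hpow : ∀ n, wordVal c (l.take i) * wordVal c ((l.take j).drop i) ^ n =
      wordVal c (l.take i) := by
    intro n
    induction n with
    | zero => simp
    | succ n ih => rw [pow_succ, ← mul_assoc, ih, hmul]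
  refine ⟨l.take i, (l.take j).drop i, l.drop j, ?_, fun n => ?_⟩
  · rw [← List.length_pos_iff]
    simp
    omega
  · rw [wordVal_append, wordVal_append, wordVal_flatten_replicate, hpow, hv, ← wordVal_append,
      List.take_append_drop, hl]

theorem unboundedPowers_of_nil [Finite A] [Finite X] [Finite M] (h : (E.sol c).Infinite)
    (hl : E.lhs = []) (hr : E.rhs = []) : E.UnboundedPowers c := by
  classical
  obtain ⟨Z, hZ⟩ := exists_wordVal_infinite h
  obtain ⟨a, p, b, hp, hpump⟩ := exists_pump hZ
  obtain ⟨σ, hσ⟩ := h.nonempty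
  intro n
  refine ⟨Function.update σ Z (a ++ (List.replicate n p).flatten ++ b), ⟨?_, fun Y => ?_⟩, Z,
    p, hp, ?_⟩
  · rw [hl, hr]
  · by_cases hY : Y = Z
    · subst hY
      rw [Function.update_self, hpump]
    · rw [Function.update_of_ne hY, hσ.2]
  · rw [Function.update_self]
    exact ⟨a, b, rfl⟩

end EqState

end Values

section Update

variable [DecidableEq X] {x : X}

theorem letterSubst_update_of_ne {σ : X → List A} {l : List A} {z : A ⊕ X}
    (hz : z ≠ Sum.inr x) : letterSubst (Function.update σ x l) z = letterSubst σ z := by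
  cases z with
  | inl a => rfl
  | inr Z => exact Function.update_of_ne (fun h => hz (by rw [h])) _ _

theorem wordSubst_update_of_notMem {σ : X → List A} {l : List A} {t : List (A ⊕ X)}
    (ht : Sum.inr x ∉ t) : wordSubst (Function.update σ x l) t = wordSubst σ t := by
  induction t with
  | nil => rfl
  | cons z t ih =>
    simp only [List.mem_cons, not_or] at ht
    rw [wordSubst_cons, wordSubst_cons, ih ht.2, letterSubst_update_of_ne (Ne.symm ht.1)]

end Update

/-! ### Nielsen moves -/

variable [DecidableEq (A ⊕ X)]

/-- The substitution `x ↦ y x` on words. -/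
def insertBefore (x : X) (y : A ⊕ X) (l : List (A ⊕ X)) : List (A ⊕ X) :=
  l.flatMap fun z => if z = Sum.inr x then [y, z] else [z]

section InsertBefore

variable {x : X} {y : A ⊕ X}

@[simp]
theorem insertBefore_nil : insertBefore x y [] = [] := rfl

theorem insertBefore_cons (z : A ⊕ X) (l : List (A ⊕ X)) :
    insertBefore x y (z :: l) =
      (if z = Sum.inr x then [y, z] else [z]) ++ insertBefore x y l := rfl

theorem insertBefore_append (l l' : List (A ⊕ X)) :
    insertBefore x y (l ++ l') = insertBefore x y l ++ insertBefore x y l' :=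
  List.flatMap_append

theorem exists_insertBefore_cons (z : A ⊕ X) (l : List (A ⊕ X)) :
    ∃ l', insertBefore x y (z :: l) = l' ++ z :: insertBefore x y l := by
  rw [insertBefore_cons]
  split_ifs
  · exact ⟨[y], rfl⟩
  · exact ⟨[], rfl⟩

theorem length_insertBefore (l : List (A ⊕ X)) :
    (insertBefore x y l).length = l.length + l.count (Sum.inr x) := by
  induction l with
  | nil => simp
  | cons z l ih =>
    rw [insertBefore_cons, List.count_cons, List.length_append, ih]
    split_ifs <;> simp_all <;> omega

theorem count_insertBefore (z : A ⊕ X) (l : List (A ⊕ X)) :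
    (insertBefore x y l).count z = l.count z + if z = y then l.count (Sum.inr x) else 0 := by
  induction l with
  | nil => simp
  | cons t l ih =>
    rw [insertBefore_cons, List.count_append, ih]
    simp only [List.count_cons, beq_iff_eq]
    by_cases ht : t = Sum.inr x
    · by_cases hz : z = y
      · subst hz
        simp [ht, List.count_cons]
        omega
      · simp [ht, List.count_cons, hz, Ne.symm hz]
        omega
    · simp [ht, List.count_cons]
      omega

theorem mem_insertBefore_of_mem {z : A ⊕ X} {l : List (A ⊕ X)} (h : z ∈ l) :
    z ∈ insertBefore x y l := by
  rw [← List.count_pos_iff] at *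
  rw [count_insertBefore]
  omega

theorem mem_insertBefore_self {l : List (A ⊕ X)} (h : Sum.inr x ∈ l) :
    y ∈ insertBefore x y l := by
  rw [← List.count_pos_iff] at *
  rw [count_insertBefore, if_pos rfl]
  omega

variable [DecidableEq X]

/-- The assignment `x ↦ σ(y) σ(x)`. -/
def expandSubst (x : X) (y : A ⊕ X) (σ : X → List A) : X → List A :=
  Function.update σ x (letterSubst σ y ++ σ x)

theorem wordSubst_expandSubst (σ : X → List A) (l : List (A ⊕ X)) :
    wordSubst (expandSubst x y σ) l = wordSubst σ (insertBefore x y l) := by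
  induction l with
  | nil => rfl
  | cons z l ih =>
    rw [wordSubst_cons, insertBefore_cons, wordSubst_append, ih]
    congr 1
    split_ifs with hz
    · subst hz
      simp [expandSubst, letterSubst]
    · simp [expandSubst, letterSubst_update_of_ne hz]

end InsertBefore

namespace EqState

variable [Monoid M] {c : A → M} {E F : EqState A X M}

/-- The length of an equation. -/
def length (E : EqState A X M) : ℕ := E.lhs.length + E.rhs.length

variable (c) in
/-- A quadratic equation with infinitely many solutions, the powers in which are bounded. -/
structure Bad (E : EqState A X M) : Prop where
  count_le : ∀ Z, (E.lhs ++ E.rhs).count (Sum.inr Z) ≤ 2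
  infinite : (E.sol c).Infinite
  bounded : ¬ E.UnboundedPowers c

theorem Bad.swap (h : E.Bad c) : E.swap.Bad c := by
  refine ⟨fun Z => ?_, by rw [swap_sol]; exact h.infinite, ?_⟩
  · have := h.count_le Z
    rw [List.count_append] at *
    simp only [EqState.swap]
    omega
  · unfold UnboundedPowers
    rw [swap_sol]
    exact h.bounded

theorem Bad.of_sublist (hE : E.Bad c) (hs : F.sol c = E.sol c)
    (hc : (F.lhs ++ F.rhs).Sublist (E.lhs ++ E.rhs)) : F.Bad c := by
  refine ⟨fun Z => (hc.count_le _).trans (hE.count_le Z), hs ▸ hE.infinite, fun h => ?_⟩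
  unfold UnboundedPowers at h
  rw [hs] at h
  exact hE.bounded h

variable (c) in
/-- `F` arises from `E` by the substitution `x ↦ y x`, where `x` and `y` are the first letters of
the two sides of `E`, followed by the cancellation of `y`; the sides of `F` may be interchanged. -/
structure Move (E F : EqState A X M) (x : X) (y : A ⊕ X) : Prop where
  ne : y ≠ Sum.inr x
  con_ne_one : E.con x ≠ 1
  letterVal_ne_one : E.letterVal c y ≠ 1
  con_eq : E.letterVal c y * F.con x = E.con x
  con_of_ne : ∀ Z, Z ≠ x → F.con Z = E.con Z
  words : ∃ s t, E.lhs = Sum.inr x :: s ∧ E.rhs = y :: t ∧ (s ++ t).count (Sum.inr x) = 1 ∧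
    (F.lhs = Sum.inr x :: insertBefore x y s ∧ F.rhs = insertBefore x y t ∨
      F.rhs = Sum.inr x :: insertBefore x y s ∧ F.lhs = insertBefore x y t)

theorem Move.swap {x : X} {y : A ⊕ X} (h : E.Move c F x y) : E.Move c F.swap x y :=
  ⟨h.ne, h.con_ne_one, h.letterVal_ne_one, h.con_eq, h.con_of_ne, by
    obtain ⟨s, t, hs, ht, hc, h⟩ := h.words
    exact ⟨s, t, hs, ht, hc, h.symm⟩⟩

/-- Every solution erases a letter of value 1, so deleting it would give a shorter bad equation. -/
theorem Bad.letterVal_ne_one (hc : ∀ l, wordVal c l = 1 → l = []) (hE : E.Bad c)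
    (hmin : ∀ F : EqState A X M, F.Bad c → E.length ≤ F.length) {z : A ⊕ X} {s : List (A ⊕ X)}
    (hl : E.lhs = z :: s) : E.letterVal c z ≠ 1 := by
  intro h
  have : EqState.Bad c (⟨s, E.rhs, E.con⟩ : EqState A X M) := by
    refine hE.of_sublist ?_ (by rw [hl]; simp)
    ext σ
    refine and_congr_left fun hσ => ?_
    have hz : letterSubst σ z = [] := hc _ (by rw [wordVal_letterSubst hσ]; exact h)
    rw [hl, wordSubst_cons, hz, List.nil_append]
  have := hmin _ this
  simp [length, hl] at this

variable [DecidableEq X]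

/-- The equation obtained by the substitution `x ↦ y x` from `x s = y t`. -/
def reduce (E : EqState A X M) (x : X) (y : A ⊕ X) (s t : List (A ⊕ X)) (q : M) :
    EqState A X M :=
  ⟨Sum.inr x :: insertBefore x y s, insertBefore x y t, Function.update E.con x q⟩

/-! ### Reducing an equation by a Nielsen substitution -/

section Reduce

variable {x : X} {y : A ⊕ X} {s t : List (A ⊕ X)} {q : M}
  (hl : E.lhs = Sum.inr x :: s) (hr : E.rhs = y :: t) (hy : y ≠ Sum.inr x)

theorem expandSubst_equation_iff {σ : X → List A} (hy : y ≠ Sum.inr x) :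
    wordSubst (expandSubst x y σ) (Sum.inr x :: s) = wordSubst (expandSubst x y σ) (y :: t) ↔
      wordSubst σ (Sum.inr x :: insertBefore x y s) = wordSubst σ (insertBefore x y t) := by
  rw [wordSubst_expandSubst, wordSubst_expandSubst, insertBefore_cons, insertBefore_cons,
    if_pos rfl, if_neg hy]
  simp

include hl hr hy

theorem expandSubst_mem_sol (hq : E.letterVal c y * q = E.con x) {σ : X → List A}
    (hσ : σ ∈ (E.reduce x y s t q).sol c) : expandSubst x y σ ∈ E.sol c := by
  obtain ⟨h, hv⟩ := hσ
  refine ⟨?_, fun Z => ?_⟩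
  · rw [hl, hr, expandSubst_equation_iff hy]
    exact h
  · by_cases hZ : Z = x
    · subst hZ
      rw [expandSubst, Function.update_self, wordVal_append, wordVal_letterSubst hv, hv, ← hq]
      simp only [reduce, Function.update_self]
      congr 1
      cases y with
      | inl a => rfl
      | inr Y => exact Function.update_of_ne (fun h => hy (by rw [h])) _ _
    · rw [expandSubst, Function.update_of_ne hZ, hv]
      exact Function.update_of_ne hZ _ _

theorem exists_eq_expandSubst {σ : X → List A} (hσ : σ ∈ E.sol c)
    (hle : (letterSubst σ y).length ≤ (σ x).length) :
    ∃ q, E.letterVal c y * q = E.con x ∧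
      ∃ τ ∈ (E.reduce x y s t q).sol c, expandSubst x y τ = σ := by
  obtain ⟨h, hv⟩ := hσ
  obtain ⟨r, hr'⟩ : letterSubst σ y <+: σ x := by
    refine List.prefix_of_prefix_length_le (l₃ := wordSubst σ E.lhs) ?_ ?_ hle
    · rw [h, hr, wordSubst_cons]
      exact List.prefix_append _ _
    · rw [hl, wordSubst_cons]
      exact List.prefix_append _ _
  have hexp : expandSubst x y (Function.update σ x r) = σ := by
    rw [expandSubst, letterSubst_update_of_ne hy, Function.update_self, hr', Function.update_idem,
      Function.update_eq_self]
  refine ⟨wordVal c r, ?_, Function.update σ x r, ⟨?_, fun Z => ?_⟩, hexp⟩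
  · rw [← wordVal_letterSubst hv, ← wordVal_append, hr', hv]
  · refine (expandSubst_equation_iff hy).1 ?_
    rw [hexp, ← hl, ← hr, h]
  · by_cases hZ : Z = x
    · subst hZ
      simp [reduce]
    · simp [reduce, hZ, hv]

/-- Each solution considered comes from a reduced equation for some q, and M is finite, so one q
retains infinitely many. High powers lift back because σ(x) remains a suffix of its new value. The
cancellation saves one letter and each remaining x costs one. -/
theorem Bad.exists_reduce [Finite M] (hE : E.Bad c)
    (hinf : {σ ∈ E.sol c | (letterSubst σ y).length ≤ (σ x).length}.Infinite) :
    ∃ q, E.letterVal c y * q = E.con x ∧ (E.reduce x y s t q).Bad c ∧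
      (E.reduce x y s t q).length + 1 = E.length + (s ++ t).count (Sum.inr x) := by
  obtain ⟨q, hq, hqinf⟩ : ∃ q, E.letterVal c y * q = E.con x ∧
      ((E.reduce x y s t q).sol c).Infinite := by
    by_contra! hfin
    refine hinf ((Set.finite_iUnion (f := fun q : {q // E.letterVal c y * q = E.con x} =>
      expandSubst x y '' (E.reduce x y s t q).sol c) fun q =>
      (hfin q q.2).image _).subset ?_)
    rintro σ ⟨hσ, hle⟩
    obtain ⟨q, hq, τ, hτ, rfl⟩ := exists_eq_expandSubst hl hr hy hσ hle
    exact Set.mem_iUnion.2 ⟨⟨q, hq⟩, τ, hτ, rfl⟩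
  have hc1 := hE.count_le x
  rw [hl, hr] at hc1
  have hc : (s ++ t).count (Sum.inr x) ≤ 1 := by
    simp only [List.cons_append, List.count_cons, List.count_append] at *
    simp at *
    omega
  refine ⟨q, hq, ⟨fun Z => ?_, hqinf, fun hun => hE.bounded fun n => ?_⟩, ?_⟩
  · have hZ := hE.count_le Z
    rw [hl, hr] at hZ
    simp only [reduce, List.cons_append, List.count_cons, List.count_append,
      count_insertBefore] at *
    by_cases hyZ : Sum.inr Z = y
    · simp [hyZ] at *
      omega
    · simp [hyZ, Ne.symm hyZ] at *
      omega
  · obtain ⟨σ, hσ, Z, hZ⟩ := hun n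
    refine ⟨_, expandSubst_mem_sol hl hr hy hq hσ, Z, hZ.of_isInfix ?_⟩
    by_cases hZx : Z = x
    · subst hZx
      rw [expandSubst, Function.update_self]
      exact (List.suffix_append _ _).isInfix
    · rw [expandSubst, Function.update_of_ne hZx]
  · simp only [length, reduce, hl, hr, List.length_cons, length_insertBefore, List.count_append]
    omega

theorem Bad.exists_move [Finite M] (hE : E.Bad c) (hmin : ∀ F : EqState A X M, F.Bad c →
    E.length ≤ F.length) (hx : E.con x ≠ 1) (hy1 : E.letterVal c y ≠ 1)
    (hinf : {σ ∈ E.sol c | (letterSubst σ y).length ≤ (σ x).length}.Infinite) :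
    ∃ F, F.Bad c ∧ F.length = E.length ∧ E.Move c F x y := by
  obtain ⟨q, hq, hbad, hlen⟩ := hE.exists_reduce hl hr hy hinf
  have hc1 := hE.count_le x
  rw [hl, hr] at hc1
  have := hmin _ hbad
  have hc : (s ++ t).count (Sum.inr x) = 1 := by
    simp only [List.cons_append, List.count_cons, List.count_append] at *
    simp at *
    omega
  refine ⟨_, hbad, by omega, hy, hx, hy1, by simpa [reduce] using hq,
    fun Z hZ => by simp [reduce, hZ], s, t, hl, hr, hc, Or.inl ⟨rfl, rfl⟩⟩

end Reduce

/-- Minimality excludes equal first letters and first letters of value 1. Comparing the lengths of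
the images of the two first letters splits the solutions in two, and an infinite half decides which
variable wins. -/
theorem Bad.exists_move_of_minimal [Finite A] [Finite X] [Finite M]
    (hc : ∀ l, wordVal c l = 1 → l = []) (hE : E.Bad c)
    (hmin : ∀ F : EqState A X M, F.Bad c → E.length ≤ F.length) :
    ∃ F E' x y, F.Bad c ∧ F.length = E.length ∧ (E' = E ∨ E' = E.swap) ∧ E'.Move c F x y := by
  have hmin' : ∀ F : EqState A X M, F.Bad c → E.swap.length ≤ F.length := by
    intro F hF
    have := hmin F hF
    simp only [EqState.swap, length] at *
    omega
  have hnil : ∀ E : EqState A X M, E.Bad c →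
      (∀ F : EqState A X M, F.Bad c → E.length ≤ F.length) → E.lhs ≠ [] := by
    intro E hE hmin hl
    obtain ⟨σ, hσ⟩ := hE.infinite.nonempty
    have hmin' : ∀ F : EqState A X M, F.Bad c → E.swap.length ≤ F.length := by
      intro F hF
      have := hmin F hF
      simp only [EqState.swap, length] at *
      omega
    rcases hr : E.rhs with _ | ⟨z, t⟩
    · exact hE.bounded (unboundedPowers_of_nil hE.infinite hl hr)
    · have h1 := letterSubst_ne_nil (E := E) hσ.2 (hE.swap.letterVal_ne_one hc hmin' hr)
      have := hσ.1
      rw [hl, hr, wordSubst_nil, wordSubst_cons] at this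
      exact h1 (List.append_eq_nil_iff.1 this.symm).1
  obtain ⟨z, s, hl⟩ := List.exists_cons_of_ne_nil (hnil E hE hmin)
  obtain ⟨y, t, hr⟩ := List.exists_cons_of_ne_nil (hnil E.swap hE.swap hmin')
  simp only [EqState.swap] at hr
  have hz1 := hE.letterVal_ne_one hc hmin hl
  have hy1 : E.letterVal c y ≠ 1 := hE.swap.letterVal_ne_one hc hmin' hr
  have hne : z ≠ y := by
    rintro rfl
    have : EqState.Bad c (⟨s, t, E.con⟩ : EqState A X M) := by
      refine hE.of_sublist ?_ ?_
      · ext σ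
        refine and_congr_left fun hσ => ?_
        rw [hl, hr]
        simp
      · rw [hl, hr]
        exact (List.sublist_cons_self _ _).append (List.sublist_cons_self _ _)
    have := hmin _ this
    simp [length, hl, hr] at this
    omega
  have hsplit : {σ ∈ E.sol c | (letterSubst σ y).length ≤ (letterSubst σ z).length}.Infinite ∨
      {σ ∈ E.sol c | (letterSubst σ z).length ≤ (letterSubst σ y).length}.Infinite := by
    rw [← Set.infinite_union]
    refine hE.infinite.mono fun σ hσ => ?_
    rcases le_total (letterSubst σ y).length (letterSubst σ z).length with h | h
    · exact Or.inl ⟨hσ, h⟩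
    · exact Or.inr ⟨hσ, h⟩
  -- The longer letter might be a constant. Then the other letter is a variable, because distinct
  -- constants cannot match, and its nonempty image has length at least 1, so the variable can be
  -- taken as the winner instead.
  have hconst : ∀ (E : EqState A X M) (a : A) (z : A ⊕ X) (s t : List (A ⊕ X)),
      E.lhs = Sum.inl a :: s → E.rhs = z :: t → Sum.inl a ≠ z → E.letterVal c z ≠ 1 →
      {σ ∈ E.sol c | (letterSubst σ z).length ≤ (letterSubst σ (Sum.inl a)).length}.Infinite →
      ∃ Z, z = Sum.inr Z ∧
      {σ ∈ E.sol c | (letterSubst σ (Sum.inl a)).length ≤ (σ Z).length}.Infinite := by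
    intro E a z s t hl hr hne hz hinf
    cases z with
    | inl b =>
      obtain ⟨σ, hσ, -⟩ := hinf.nonempty
      have := hσ.1
      rw [hl, hr] at this
      simp only [wordSubst_cons, letterSubst, Sum.elim_inl, List.singleton_append,
        List.cons.injEq] at this
      exact absurd (congrArg Sum.inl this.1) hne
    | inr Z =>
      refine ⟨Z, rfl, hinf.mono fun σ hσ => ⟨hσ.1, ?_⟩⟩
      have := List.length_pos_iff.2 (letterSubst_ne_nil hσ.1.2 hz)
      simpa [letterSubst, Nat.one_le_iff_ne_zero, Nat.pos_iff_ne_zero] using this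
  have hleft : ∀ Z, z = Sum.inr Z →
      {σ ∈ E.sol c | (letterSubst σ y).length ≤ (σ Z).length}.Infinite →
      ∃ F E' x y, F.Bad c ∧ F.length = E.length ∧ (E' = E ∨ E' = E.swap) ∧ E'.Move c F x y := by
    rintro Z rfl hinf
    obtain ⟨F, hF, hlen, hmove⟩ := hE.exists_move hl hr hne.symm hmin hz1 hy1 hinf
    exact ⟨F, E, Z, y, hF, hlen, Or.inl rfl, hmove⟩
  have hright : ∀ Z, y = Sum.inr Z →
      {σ ∈ E.sol c | (letterSubst σ z).length ≤ (σ Z).length}.Infinite →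
      ∃ F E' x y, F.Bad c ∧ F.length = E.length ∧ (E' = E ∨ E' = E.swap) ∧ E'.Move c F x y := by
    rintro Z rfl hinf
    obtain ⟨F, hF, hlen, hmove⟩ := hE.swap.exists_move hr hl hne hmin' hy1 hz1
      (by rw [swap_sol]; exact hinf)
    refine ⟨F, E.swap, Z, z, hF, ?_, Or.inr rfl, hmove⟩
    rw [hlen]
    simp only [EqState.swap, length]
    omega
  rcases hsplit with h | h
  · cases z with
    | inr Z => exact hleft Z rfl h
    | inl a =>
      obtain ⟨Z, hZ, h⟩ := hconst E a y s t hl hr hne hy1 h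
      exact hright Z hZ h
  · cases y with
    | inr Z => exact hright Z rfl h
    | inl a =>
      obtain ⟨Z, hZ, h⟩ := hconst E.swap a z t s hr hl hne.symm hz1 (by rw [swap_sol]; exact h)
      exact hleft Z hZ (by rw [swap_sol] at h; exact h)

theorem Bad.exists_path [Finite A] [Finite X] [Finite M]
    (hc : ∀ l, wordVal c l = 1 → l = []) (hE : E.Bad c) :
    ∃ (G : ℕ → EqState A X M) (x : ℕ → X) (y : ℕ → A ⊕ X), ∀ i, (G i).Bad c ∧
      (G i).Move c (G (i + 1)) (x i) (y i) := by
  obtain ⟨E₀, hE₀, hmin⟩ : ∃ E₀ : EqState A X M, E₀.Bad c ∧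
      ∀ F : EqState A X M, F.Bad c → E₀.length ≤ F.length := by
    obtain ⟨E₀, h, hmin⟩ := (measure (length : EqState A X M → ℕ)).wf.has_min {F | F.Bad c} ⟨E, hE⟩
    exact ⟨E₀, h, fun F hF => not_lt.1 (hmin F hF)⟩
  let P := {F : EqState A X M // F.Bad c ∧ F.length = E₀.length}
  have hstep : ∀ F : P, ∃ (F' : P) (E' : EqState A X M) (x : X) (y : A ⊕ X),
      (E' = F.1 ∨ E' = F.1.swap) ∧ E'.Move c F'.1 x y := by
    rintro ⟨F, hF, hlen⟩
    obtain ⟨F', E', x, y, hF', hlen', h⟩ :=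
      hF.exists_move_of_minimal hc fun G hG => hlen ▸ hmin G hG
    exact ⟨⟨F', hF', hlen' ▸ hlen⟩, E', x, y, h⟩
  choose f g x y hg hmove using hstep
  let e : ℕ → P := fun i => f^[i] ⟨E₀, hE₀, rfl⟩
  -- Each equation is oriented for the move that leaves it. The two possible orders of the sides in
  -- `Move` absorb the mismatch with the preceding move.
  refine ⟨fun i => g (e i), fun i => x (e i), fun i => y (e i), fun i => ⟨?_, ?_⟩⟩
  · change (g (e i)).Bad c
    rcases hg (e i) with h | h
    · rw [h]
      exact (e i).2.1
    · rw [h]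
      exact (e i).2.1.swap
  · have he : f (e i) = e (i + 1) := (Function.iterate_succ_apply' f i _).symm
    have := hmove (e i)
    rw [he] at this
    rcases hg (e (i + 1)) with h | h
    · simp only [h]
      exact this
    · simp only [h]
      exact this.swap

end EqState

end EquationStates

/-! ### Infinite paths of Nielsen moves -/

namespace EqState

variable {A : Type v} {X : Type w} {M : Type u} [Monoid M] {c : A → M}

/-- In xs = axb with no further x, a power of σ(a) placed before σ(x) commutes past σ(a), so the
equation persists. The constraint persists when the exponent is a multiple of the period of the
value of a on `E.con x`. -/
theorem unboundedPowers_of_lStab [DecidableEq X] (hM : LStabilizing M) {E : EqState A X M}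
    {x : X} {s a b : List (A ⊕ X)} {σ : X → List A} (hσ : σ ∈ E.sol c)
    (hl : E.lhs = Sum.inr x :: s) (hr : E.rhs = a ++ Sum.inr x :: b)
    (hs : Sum.inr x ∉ s) (ha : Sum.inr x ∉ a) (hb : Sum.inr x ∉ b) (hne : wordSubst σ a ≠ [])
    (hstab : ∀ z ∈ a, LStab (E.letterVal c z) (E.con x)) : E.UnboundedPowers c := by
  obtain ⟨h, hv⟩ := hσ
  have hstab' : LStab (wordVal c (wordSubst σ a)) (E.con x) := by
    rw [wordVal_wordSubst hv]
    refine hM.list_prod fun m hm => ?_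
    obtain ⟨z, hz, rfl⟩ := List.mem_map.1 hm
    exact hstab z hz
  obtain ⟨n, hn, hpow⟩ := hM.exists_pow _ _ hstab'
  intro k
  set p := (List.replicate (n * k) (wordSubst σ a)).flatten with hp
  have hcomm : p ++ wordSubst σ a = wordSubst σ a ++ p := by
    have h1 : p ++ wordSubst σ a = (List.replicate (n * k + 1) (wordSubst σ a)).flatten := by
      rw [List.replicate_succ', List.flatten_append, hp]
      simp
    rw [h1, List.replicate_succ, List.flatten_cons, hp]
  refine ⟨Function.update σ x (p ++ σ x), ⟨?_, fun Z => ?_⟩, x, ?_⟩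
  · have hx : letterSubst (Function.update σ x (p ++ σ x)) (Sum.inr x) = p ++ σ x :=
      Function.update_self ..
    rw [hl, hr] at h ⊢
    rw [wordSubst_append, wordSubst_cons, wordSubst_cons] at h ⊢
    rw [wordSubst_update_of_notMem hs, wordSubst_update_of_notMem ha,
      wordSubst_update_of_notMem hb, hx]
    change σ x ++ _ = _ ++ (σ x ++ _) at h
    rw [List.append_assoc, h, List.append_assoc, ← List.append_assoc p, hcomm]
    simp
  · by_cases hZ : Z = x
    · subst hZ
      rw [Function.update_self, wordVal_append, hp, wordVal_flatten_replicate, hv, pow_mul,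
        pow_mul_eq_self hpow]
    · rw [Function.update_of_ne hZ, hv]
  · rw [Function.update_self]
    have : HasPower (n * k) p := ⟨_, hne, List.infix_rfl⟩
    exact (this.of_isInfix (List.prefix_append _ _).isInfix).mono (Nat.le_mul_of_pos_left k hn)

variable [DecidableEq (A ⊕ X)]

variable (c) in
/-- An infinite path of Nielsen moves along which the `L`-classes of the constraints are constant
and every winning variable wins infinitely often. -/
structure RecurrentPath (G : ℕ → EqState A X M) (x : ℕ → X) (y : ℕ → A ⊕ X) : Prop where
  bad : ∀ i, (G i).Bad c
  move : ∀ i, (G i).Move c (G (i + 1)) (x i) (y i)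
  con_le : ∀ i j Z, ∃ r, r * (G i).con Z = (G j).con Z
  recur : ∀ i n, ∃ j ≥ n, x j = x i

theorem Move.exists_mul_con {E F : EqState A X M} {x : X} {y : A ⊕ X} (h : E.Move c F x y)
    (Z : X) : ∃ r, r * F.con Z = E.con Z := by
  by_cases hZ : Z = x
  · subst hZ
    exact ⟨_, h.con_eq⟩
  · exact ⟨1, by rw [one_mul, h.con_of_ne Z hZ]⟩

theorem Bad.exists_recurrentPath [DecidableEq X] [Finite A] [Finite X] [Finite M]
    (hc : ∀ l, wordVal c l = 1 → l = []) {E : EqState A X M} (hE : E.Bad c) :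
    ∃ (G : ℕ → EqState A X M) (x : ℕ → X) (y : ℕ → A ⊕ X), RecurrentPath c G x y := by
  obtain ⟨G, x, y, h⟩ := hE.exists_path hc
  -- The left ideals generated by the constraints increase along the path. Once they are stationary,
  -- so are the L-classes.
  let I : ℕ → X → Set M := fun i Z => Set.range (· * (G i).con Z)
  have hI : Monotone I := by
    refine monotone_nat_of_le_succ fun i Z => ?_
    rintro _ ⟨s, rfl⟩
    obtain ⟨r, hr⟩ := (h i).2.exists_mul_con Z
    exact ⟨s * r, by simp only [mul_assoc, hr]⟩
  obtain ⟨N, hN⟩ := WellFoundedGT.monotone_chain_condition (⟨I, hI⟩ : ℕ →o (X → Set M))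
  have hev : ∀ᶠ i in Filter.atTop, ∀ Z, (¬ ∃ᶠ j in Filter.atTop, x j = Z) → x i ≠ Z := by
    refine Filter.eventually_all.2 fun Z => ?_
    by_cases hZ : ∃ᶠ j in Filter.atTop, x j = Z
    · exact Filter.Eventually.of_forall fun i hi => absurd hZ hi
    · filter_upwards [Filter.not_frequently.1 hZ] with i hi _
      exact hi
  obtain ⟨N', hN'⟩ := Filter.eventually_atTop.1 hev
  set K := max N N'
  refine ⟨fun i => G (i + K), fun i => x (i + K), fun i => y (i + K), fun i => (h _).1,
    fun i => ?_, fun i j Z => ?_, fun i n => ?_⟩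
  · have := (h (i + K)).2
    rwa [add_right_comm] at this
  · have h1 : I N = I (i + K) := hN (i + K) (by omega)
    have h2 : I N = I (j + K) := hN (j + K) (by omega)
    have : (G (j + K)).con Z ∈ I (i + K) Z := by
      rw [← h1, h2]
      exact ⟨1, one_mul _⟩
    exact this
  · have : ∃ᶠ j in Filter.atTop, x j = x (i + K) := by
      by_contra hf
      exact hN' (i + K) (by omega) _ hf rfl
    obtain ⟨j, hj, hx⟩ := Filter.frequently_atTop.1 this (n + K)
    exact ⟨j - K, by omega, by rwa [Nat.sub_add_cancel (by omega)]⟩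

/-- The move loses the leading y and gains one y before the single other occurrence of x. -/
theorem Move.count_eq {E F : EqState A X M} {x : X} {y : A ⊕ X} (h : E.Move c F x y)
    (z : A ⊕ X) : (F.lhs ++ F.rhs).count z = (E.lhs ++ E.rhs).count z := by
  obtain ⟨s, t, hl, hr, hc, hF⟩ := h.words
  rw [List.count_append] at hc
  have key : (Sum.inr x :: insertBefore x y s).count z + (insertBefore x y t).count z =
      (E.lhs ++ E.rhs).count z := by
    rw [hl, hr]
    simp only [List.count_append, List.count_cons, count_insertBefore]
    by_cases hz : z = y
    · simp [hz]
      omega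
    · simp [hz, Ne.symm hz]
  rw [← key, List.count_append]
  rcases hF with ⟨h1, h2⟩ | ⟨h1, h2⟩
  · rw [h1, h2]
  · rw [h1, h2, add_comm]

theorem Move.count_two {E F : EqState A X M} {x : X} {y : A ⊕ X} (h : E.Move c F x y) :
    (E.lhs ++ E.rhs).count (Sum.inr x) = 2 := by
  obtain ⟨s, t, hl, hr, hc, -⟩ := h.words
  rw [List.count_append] at hc
  rw [hl, hr]
  simp [List.count_append, h.ne]
  omega

/-- A factorization `a z b` of one side of an equation persists under a Nielsen move, unless `z`
is the letter that is cancelled. -/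
theorem Move.exists_side {E F : EqState A X M} {x : X} {y z : A ⊕ X} (h : E.Move c F x y)
    (hz : y ≠ z) {a b : List (A ⊕ X)} (hE : E.lhs = a ++ z :: b ∨ E.rhs = a ++ z :: b) :
    ∃ a', F.lhs = a' ++ z :: insertBefore x y b ∨ F.rhs = a' ++ z :: insertBefore x y b := by
  obtain ⟨s, t, hl, hr, -, hF⟩ := h.words
  have hins : ∀ a₀, ∃ a', insertBefore x y (a₀ ++ z :: b) = a' ++ z :: insertBefore x y b := by
    intro a₀
    obtain ⟨l', hl'⟩ := exists_insertBefore_cons (x := x) (y := y) z b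
    exact ⟨insertBefore x y a₀ ++ l', by rw [insertBefore_append, hl', List.append_assoc]⟩
  have : (∃ a', Sum.inr x :: insertBefore x y s = a' ++ z :: insertBefore x y b) ∨
      ∃ a', insertBefore x y t = a' ++ z :: insertBefore x y b := by
    rcases hE with hE | hE
    · left
      rw [hl] at hE
      rcases a with _ | ⟨_, a₀⟩
      · simp only [List.nil_append, List.cons.injEq] at hE
        exact ⟨[], by rw [hE.1, hE.2, List.nil_append]⟩
      · simp only [List.cons_append, List.cons.injEq] at hE
        obtain ⟨a', ha'⟩ := hins a₀
        exact ⟨Sum.inr x :: a', by rw [hE.2, ha', List.cons_append]⟩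
    · right
      rw [hr] at hE
      rcases a with _ | ⟨_, a₀⟩
      · simp only [List.nil_append, List.cons.injEq] at hE
        exact absurd hE.1 hz
      · simp only [List.cons_append, List.cons.injEq] at hE
        rw [hE.2]
        exact hins a₀
  rcases hF with ⟨h1, h2⟩ | ⟨h1, h2⟩ <;> rw [h1, h2] <;> rcases this with ⟨a', h⟩ | ⟨a', h⟩
  · exact ⟨a', Or.inl h⟩
  · exact ⟨a', Or.inr h⟩
  · exact ⟨a', Or.inr h⟩
  · exact ⟨a', Or.inl h⟩

/-! ### Losers stabilize winners, and the final contradiction -/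

namespace RecurrentPath

variable {G : ℕ → EqState A X M} {x : ℕ → X} {y : ℕ → A ⊕ X} (hG : RecurrentPath c G x y)
include hG

theorem lStab_congr (hM : LStabilizing M) {i j i' j' : ℕ} {z : A ⊕ X} {Z : X}
    (h : LStab ((G i).letterVal c z) ((G j).con Z)) :
    LStab ((G i').letterVal c z) ((G j').con Z) := by
  obtain ⟨s, hs⟩ := hG.con_le j j' Z
  obtain ⟨t, ht⟩ := hG.con_le j' j Z
  rw [← hs]
  refine hM.congr _ _ s t (by rw [hs, ht]) ?_
  cases z with
  | inl a => exact h
  | inr Y =>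
    obtain ⟨r, hr⟩ := hG.con_le i' i Y
    exact LStab.of_eq_mul hr.symm h

/-- The old constraint of the winner is the value of the loser times the new one, and both
constraints lie in the same L-class. -/
theorem lStab_loser_winner (hM : LStabilizing M) (i : ℕ) :
    LStab ((G 0).letterVal c (y i)) ((G 0).con (x i)) := by
  refine hG.lStab_congr hM (i := i) (j := i + 1) ?_
  obtain ⟨r, hr⟩ := hG.con_le i (i + 1) (x i)
  exact ⟨r, by rw [(hG.move i).con_eq, hr]⟩

/-- After the cancellation the winner still heads a side, so it takes part in the next move. -/
theorem winner_succ (i : ℕ) : x (i + 1) = x i ∨ y (i + 1) = Sum.inr (x i) := by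
  obtain ⟨s, t, -, -, -, hF⟩ := (hG.move i).words
  obtain ⟨s', t', hl, hr, -, -⟩ := (hG.move (i + 1)).words
  rw [hl, hr] at hF
  rcases hF with ⟨h, -⟩ | ⟨h, -⟩
  · left
    simp only [List.cons.injEq, Sum.inr.injEq] at h
    exact h.1
  · right
    simp only [List.cons.injEq] at h
    exact h.1

theorem winner_chain (hM : LStabilizing M) (i k : ℕ) : x i = x (i + k) ∨
    LStab ((G 0).letterVal c (Sum.inr (x i))) ((G 0).con (x (i + k))) := by
  induction k with
  | zero => exact Or.inl rfl
  | succ k ih =>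
    rw [← add_assoc]
    rcases hG.winner_succ (i + k) with h | h
    · rwa [h]
    · have := hG.lStab_loser_winner hM (i + k + 1)
      rw [h] at this
      rcases ih with ih | ih
      · exact Or.inr (ih ▸ this)
      · exact Or.inr (hM.trans ih this)

/-- The variable `x j` wins again after time i, and the chain of winners from `x i` to that moment
transmits stabilization. -/
theorem lStab_loser (hM : LStabilizing M) (i j : ℕ) :
    LStab ((G 0).letterVal c (y i)) ((G 0).con (x j)) := by
  obtain ⟨k, hk, hx⟩ := hG.recur j i
  obtain ⟨k, rfl⟩ := Nat.exists_eq_add_of_le hk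
  have := hG.lStab_loser_winner hM i
  rw [← hx]
  rcases hG.winner_chain hM i k with h | h
  · rwa [← h]
  · exact hM.trans this h

theorem count_eq (z : A ⊕ X) (i : ℕ) :
    ((G i).lhs ++ (G i).rhs).count z = ((G 0).lhs ++ (G 0).rhs).count z := by
  induction i with
  | zero => rfl
  | succ i ih => rw [(hG.move i).count_eq, ih]

theorem length_eq (i : ℕ) :
    ((G i).lhs ++ (G i).rhs).length = ((G 0).lhs ++ (G 0).rhs).length :=
  (List.perm_iff_count.2 fun z => hG.count_eq z i).length_eq

theorem count_winner (i k : ℕ) : ((G i).lhs ++ (G i).rhs).count (Sum.inr (x k)) = 2 := by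
  rw [hG.count_eq, ← hG.count_eq _ k, (hG.move k).count_two]

/-- A letter to the left of a winning variable is cancelled eventually. -/
theorem exists_loser_eq {i k : ℕ} {z : A ⊕ X} {a b : List (A ⊕ X)}
    (h : (G i).lhs = a ++ z :: b ∨ (G i).rhs = a ++ z :: b) (hb : Sum.inr (x k) ∈ b) :
    ∃ j, y j = z := by
  by_contra! hne
  have hstep : ∀ d i a b, ((G i).lhs = a ++ z :: b ∨ (G i).rhs = a ++ z :: b) →
      Sum.inr (x k) ∈ b → ∃ a' b', ((G (i + d)).lhs = a' ++ z :: b' ∨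
        (G (i + d)).rhs = a' ++ z :: b') ∧ Sum.inr (x k) ∈ b' ∧ b.length ≤ b'.length := by
    intro d i a b h hb
    induction d with
    | zero => exact ⟨a, b, h, hb, le_rfl⟩
    | succ d ih =>
      obtain ⟨a', b', h', hb', hlen⟩ := ih
      obtain ⟨a'', h''⟩ := (hG.move (i + d)).exists_side (hne _) h'
      refine ⟨a'', _, h'', mem_insertBefore_of_mem hb', ?_⟩
      rw [length_insertBefore]
      omega
  -- While z survives, every win of `x k` lengthens the word to its right, but the total length of
  -- the equation is constant.
  have hgrow : ∀ n, ∃ i a b, ((G i).lhs = a ++ z :: b ∨ (G i).rhs = a ++ z :: b) ∧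
      Sum.inr (x k) ∈ b ∧ n ≤ b.length := by
    intro n
    induction n with
    | zero => exact ⟨i, a, b, h, hb, Nat.zero_le _⟩
    | succ n ih =>
      obtain ⟨i, a, b, h, hb, hn⟩ := ih
      obtain ⟨j, hj, hx⟩ := hG.recur k i
      obtain ⟨d, rfl⟩ := Nat.exists_eq_add_of_le hj
      obtain ⟨a', b', h', hb', hlen⟩ := hstep d i a b h hb
      obtain ⟨a'', h''⟩ := (hG.move (i + d)).exists_side (hne _) h'
      refine ⟨_, a'', _, h'', mem_insertBefore_of_mem hb', ?_⟩
      rw [length_insertBefore, hx]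
      have := List.count_pos_iff.2 hb'
      omega
  obtain ⟨j, a', b', h', -, hlen⟩ := hgrow ((G 0).lhs ++ (G 0).rhs).length
  rw [← hG.length_eq j, List.length_append] at hlen
  rcases h' with h' | h' <;> rw [h'] at hlen <;> simp at hlen <;> omega

/-- At some time, one of the leading letters is a winning variable that lies on both sides. -/
theorem exists_mem_both_sides [Finite X] : ∃ i k,
    ((G i).lhs.head? = some (Sum.inr (x k)) ∧ Sum.inr (x k) ∈ (G i).rhs) ∨
      ((G i).rhs.head? = some (Sum.inr (x k)) ∧ Sum.inr (x k) ∈ (G i).lhs) := by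
  by_contra! hno
  -- If there is no such moment, a winning variable on both sides heads neither of them, so it stays
  -- on both sides after a move.
  let B : ℕ → Set X := fun i =>
    {Z | (∃ k, x k = Z) ∧ Sum.inr Z ∈ (G i).lhs ∧ Sum.inr Z ∈ (G i).rhs}
  have hB : Monotone B := by
    refine monotone_nat_of_le_succ fun i => ?_
    rintro _ ⟨⟨k, rfl⟩, h1, h2⟩
    obtain ⟨s, t, hl, hr, -, hF⟩ := (hG.move i).words
    obtain ⟨hn1, hn2⟩ := hno i k
    rw [hl, List.head?_cons] at hn1
    rw [hr, List.head?_cons] at hn2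
    have hs : Sum.inr (x k) ∈ s := by
      rw [hl] at h1
      exact (List.mem_cons.1 h1).resolve_left fun h => hn1 (by rw [h]) h2
    have ht : Sum.inr (x k) ∈ t := by
      rw [hr] at h2
      exact (List.mem_cons.1 h2).resolve_left fun h => hn2 (by rw [h]) h1
    refine ⟨⟨k, rfl⟩, ?_⟩
    have h3 : Sum.inr (x k) ∈ Sum.inr (x i) :: insertBefore (x i) (y i) s :=
      List.mem_cons_of_mem _ (mem_insertBefore_of_mem hs)
    have h4 : Sum.inr (x k) ∈ insertBefore (x i) (y i) t := mem_insertBefore_of_mem ht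
    rcases hF with ⟨e1, e2⟩ | ⟨e1, e2⟩ <;> rw [e1, e2]
    · exact ⟨h3, h4⟩
    · exact ⟨h4, h3⟩
  -- A losing variable that is also a winner has both occurrences on the right, while both
  -- occurrences of `x i` are on the left. The substitution therefore puts a copy of the loser on
  -- the left, and its second occurrence stays on the right.
  have hnew : ∀ i k, y i = Sum.inr (x k) → x k ∉ B i ∧ x k ∈ B (i + 1) := by
    intro i k hy
    obtain ⟨s, t, hl, hr, hc, hF⟩ := (hG.move i).words
    have hn2 := (hno i k).2 (by rw [hr, List.head?_cons, hy])
    have hn1 := (hno i i).1 (by rw [hl, List.head?_cons])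
    refine ⟨fun h => hn2 h.2.1, ⟨k, rfl⟩, ?_⟩
    have hxs : Sum.inr (x i) ∈ s := by
      rw [List.count_append, List.count_eq_zero_of_not_mem (l := t)] at hc
      · exact List.count_pos_iff.1 (by omega)
      · intro h
        exact hn1 (by rw [hr]; exact List.mem_cons_of_mem _ h)
    have hyt : Sum.inr (x k) ∈ t := by
      have := hG.count_winner i k
      rw [List.count_append, List.count_eq_zero_of_not_mem hn2, hr, hy, List.count_cons_self]
        at this
      exact List.count_pos_iff.1 (by omega)
    have h3 : Sum.inr (x k) ∈ Sum.inr (x i) :: insertBefore (x i) (y i) s :=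
      List.mem_cons_of_mem _ (hy ▸ mem_insertBefore_self hxs)
    have h4 : Sum.inr (x k) ∈ insertBefore (x i) (y i) t := mem_insertBefore_of_mem hyt
    rcases hF with ⟨e1, e2⟩ | ⟨e1, e2⟩ <;> rw [e1, e2]
    · exact ⟨h3, h4⟩
    · exact ⟨h4, h3⟩
  obtain ⟨N, hN⟩ := WellFoundedGT.monotone_chain_condition (⟨B, hB⟩ : ℕ →o Set X)
  have hlose : ∀ i k, N ≤ i → y i ≠ Sum.inr (x k) := by
    intro i k hi hy
    obtain ⟨h1, h2⟩ := hnew i k hy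
    have e1 : B N = B i := hN i hi
    have e2 : B N = B (i + 1) := hN (i + 1) (by omega)
    rw [← e2, e1] at h2
    exact h1 h2
  -- Once B is stationary no winning variable loses, so the winner keeps heading the left side. The
  -- right side does not contain it and sheds one letter at every move, an infinite descent.
  have hdesc : ∀ n, (G (N + n)).rhs.length + n = (G N).rhs.length := by
    intro n
    induction n with
    | zero => rfl
    | succ n ih =>
      obtain ⟨s, t, hl, hr, -, hF⟩ := (hG.move (N + n)).words
      obtain ⟨s', t', -, hr', -, -⟩ := (hG.move (N + n + 1)).words
      have hn1 := (hno (N + n) (N + n)).1 (by rw [hl, List.head?_cons])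
      rw [hr, List.mem_cons, not_or] at hn1
      rcases hF with ⟨-, e⟩ | ⟨e, -⟩
      · rw [← add_assoc N, e, length_insertBefore, List.count_eq_zero_of_not_mem hn1.2, ← ih, hr,
          List.length_cons]
        omega
      · rw [hr', List.cons.injEq] at e
        exact absurd e.1 (hlose _ _ (by omega))
  have := hdesc ((G N).rhs.length + 1)
  omega

theorem false_of_lStabilizing [DecidableEq X] [Finite X] (hM : LStabilizing M) : False := by
  obtain ⟨i, k, h⟩ := hG.exists_mem_both_sides
  -- Swapping the sides if necessary makes the doubly placed variable head the left side, so that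
  -- the equation has the shape xs = axb.
  have key : ∀ E : EqState A X M, (E = G i ∨ E = (G i).swap) →
      E.lhs.head? = some (Sum.inr (x k)) → Sum.inr (x k) ∈ E.rhs → False := by
    intro E hE hhead hmem
    have hbad : E.Bad c := by
      rcases hE with rfl | rfl
      exacts [hG.bad i, (hG.bad i).swap]
    have hcon : E.con = (G i).con := by rcases hE with rfl | rfl <;> rfl
    have hval : E.letterVal c = (G i).letterVal c := by rcases hE with rfl | rfl <;> rfl
    have hcount : E.lhs.count (Sum.inr (x k)) + E.rhs.count (Sum.inr (x k)) = 2 := by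
      have := hG.count_winner i k
      rw [List.count_append] at this
      rcases hE with rfl | rfl
      · exact this
      · rw [add_comm]
        exact this
    have hside : ∀ l, E.rhs = l → (G i).lhs = l ∨ (G i).rhs = l := by
      rintro l rfl
      rcases hE with rfl | rfl
      exacts [Or.inr rfl, Or.inl rfl]
    have hfirst : ∃ z t, E.rhs = z :: t ∧ z ≠ Sum.inr (x k) ∧ E.letterVal c z ≠ 1 := by
      obtain ⟨s, t, hl, hr, -, -⟩ := (hG.move i).words
      rw [hval]
      rcases hE with rfl | rfl
      · rw [hl, List.head?_cons, Option.some_inj] at hhead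
        exact ⟨_, t, hr, hhead ▸ (hG.move i).ne, (hG.move i).letterVal_ne_one⟩
      · simp only [EqState.swap, hr, List.head?_cons, Option.some_inj] at hhead
        exact ⟨_, s, hl, hhead ▸ (hG.move i).ne.symm, (hG.move i).con_ne_one⟩
    obtain ⟨z, t, hz, hzx, hz1⟩ := hfirst
    obtain ⟨s, hs⟩ : ∃ s, E.lhs = Sum.inr (x k) :: s := by
      rcases hlhs : E.lhs with _ | ⟨z', s⟩
      · simp [hlhs] at hhead
      · rw [hlhs, List.head?_cons, Option.some_inj] at hhead
        exact ⟨s, by rw [hhead]⟩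
    obtain ⟨a, b, hab⟩ := List.append_of_mem hmem
    rw [hs, hab] at hcount
    simp only [List.count_cons_self, List.count_append] at hcount
    obtain ⟨σ, hσ⟩ := hbad.infinite.nonempty
    refine hbad.bounded (unboundedPowers_of_lStab hM hσ hs hab
      (List.count_eq_zero.1 (by omega)) (List.count_eq_zero.1 (by omega))
      (List.count_eq_zero.1 (by omega)) ?_ fun z' hz' => ?_)
    · rw [hab] at hz
      rcases a with _ | ⟨z', a⟩
      · simp only [List.nil_append, List.cons.injEq] at hz
        exact absurd hz.1.symm hzx
      · simp only [List.cons_append, List.cons.injEq] at hz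
        rw [wordSubst_cons, hz.1]
        exact fun h => letterSubst_ne_nil hσ.2 hz1 (List.append_eq_nil_iff.1 h).1
    · obtain ⟨a₁, a₂, rfl⟩ := List.append_of_mem hz'
      obtain ⟨j, rfl⟩ := hG.exists_loser_eq (i := i) (k := k) (z := z') (a := a₁)
        (b := a₂ ++ Sum.inr (x k) :: b) (hside _ (by rw [hab]; simp)) (by simp)
      rw [hval, hcon]
      exact hG.lStab_congr hM (hG.lStab_loser hM j k)
  rcases h with ⟨h1, h2⟩ | ⟨h1, h2⟩
  · exact key _ (Or.inl rfl) h1 h2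
  · exact key _ (Or.inr rfl) h1 h2

end RecurrentPath

theorem unboundedPowers_of_infinite [DecidableEq X] [Finite A] [Finite X] [Finite M]
    (hM : LStabilizing M) (hc : ∀ l, wordVal c l = 1 → l = []) {E : EqState A X M}
    (hE : ∀ Z, (E.lhs ++ E.rhs).count (Sum.inr Z) ≤ 2) (hinf : (E.sol c).Infinite) :
    E.UnboundedPowers c := by
  by_contra h
  have hbad : E.Bad c := ⟨hE, hinf, h⟩
  obtain ⟨G, x, y, hG⟩ := hbad.exists_recurrentPath hc
  exact hG.false_of_lStabilizing hM

end EqState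

/-! ### Reversal -/

theorem HasPower.reverse {A : Type v} {n : ℕ} {l : List A} (h : HasPower n l) :
    HasPower n l.reverse := by
  obtain ⟨p, hp, a, b, rfl⟩ := h
  refine ⟨p.reverse, by simpa using hp, b.reverse, a.reverse, ?_⟩
  simp [List.reverse_flatten, List.map_replicate, List.reverse_replicate]

namespace EqState

variable {A : Type v} {X : Type w} {M : Type u}

theorem wordSubst_reverse (σ : X → List A) (l : List (A ⊕ X)) :
    wordSubst (fun Z => (σ Z).reverse) l.reverse = (wordSubst σ l).reverse := by
  induction l with
  | nil => rfl
  | cons z l ih =>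
    rw [List.reverse_cons, wordSubst_append, ih, wordSubst_cons, wordSubst_cons,
      List.reverse_append, wordSubst_nil, List.append_nil]
    cases z <;> rfl

variable [Monoid M] {c : A → M} {E : EqState A X M}

theorem wordVal_op_reverse (l : List A) :
    wordVal (fun a => MulOpposite.op (c a)) l.reverse = MulOpposite.op (wordVal c l) := by
  rw [wordVal, wordVal, MulOpposite.op_list_prod, List.map_reverse, List.map_map]
  rfl

/-- The equation read from right to left. -/
def reverse (E : EqState A X M) : EqState A X Mᵐᵒᵖ :=
  ⟨E.lhs.reverse, E.rhs.reverse, fun Z => MulOpposite.op (E.con Z)⟩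

theorem reverse_mem_sol_iff {σ : X → List A} :
    (fun Z => (σ Z).reverse) ∈ E.reverse.sol (fun a => MulOpposite.op (c a)) ↔ σ ∈ E.sol c := by
  simp [sol, reverse, wordSubst_reverse, wordVal_op_reverse]

theorem unboundedPowers_of_infinite_of_op [DecidableEq (A ⊕ X)] [DecidableEq X] [Finite A]
    [Finite X] [Finite M] (hM : LStabilizing Mᵐᵒᵖ) (hc : ∀ l, wordVal c l = 1 → l = [])
    (hE : ∀ Z, (E.lhs ++ E.rhs).count (Sum.inr Z) ≤ 2) (hinf : (E.sol c).Infinite) :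
    E.UnboundedPowers c := by
  have : Finite Mᵐᵒᵖ := Finite.of_equiv M MulOpposite.opEquiv
  have hinj : Function.Injective fun (σ : X → List A) (Z : X) => (σ Z).reverse :=
    fun σ τ h => funext fun Z => List.reverse_injective (congrFun h Z)
  have hun : E.reverse.UnboundedPowers fun a => MulOpposite.op (c a) := by
    refine unboundedPowers_of_infinite hM (fun l hl => ?_) (fun Z => ?_) ?_
    · rw [← l.reverse_reverse, wordVal_op_reverse] at hl
      simpa using hc _ (MulOpposite.op_injective hl)
    · have := hE Z
      rw [List.count_append] at this ⊢
      simpa [reverse] using this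
    · refine (hinf.image hinj.injOn).mono ?_
      rintro _ ⟨σ, hσ, rfl⟩
      exact reverse_mem_sol_iff.2 hσ
  intro n
  obtain ⟨τ, hτ, Z, hZ⟩ := hun n
  refine ⟨fun Z => (τ Z).reverse, reverse_mem_sol_iff.1 (by simpa using hτ), Z, hZ.reverse⟩

end EqState

/-! ### From free semigroups to lists -/

section FreeSemigroups

variable {A : Type v} {X : Type w} {S : Type u} [Semigroup S]

/-- The list of letters of a nonempty word. -/
def letters (t : FreeSemigroup A) : List A := (toFreeMonoid t).toList

@[simp]
theorem letters_of (a : A) : letters (FreeSemigroup.of a) = [a] := rfl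

@[simp]
theorem letters_mul (s t : FreeSemigroup A) : letters (s * t) = letters s ++ letters t := by
  simp [letters]

theorem letters_eq (t : FreeSemigroup A) : letters t = t.head :: t.tail := by
  induction t using FreeSemigroup.recOnMul with
  | ih1 a => rfl
  | ih2 a t h1 h2 => rw [letters_mul, h1, h2]; rfl

theorem letters_injective : Function.Injective (letters : FreeSemigroup A → List A) := by
  intro s t h
  rw [letters_eq, letters_eq, List.cons.injEq] at h
  exact FreeSemigroup.ext h.1 h.2

theorem exists_letters_eq {l : List A} (hl : l ≠ []) : ∃ t, letters t = l := by
  obtain ⟨a, l, rfl⟩ := List.exists_cons_of_ne_nil hl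
  exact ⟨⟨a, l⟩, letters_eq _⟩

theorem letters_extendSubst (σ : X → FreeSemigroup A) (t : FreeSemigroup (A ⊕ X)) :
    letters (extendSubst σ t) = wordSubst (fun Z => letters (σ Z)) (letters t) := by
  induction t using FreeSemigroup.recOnMul with
  | ih1 z => cases z <;> simp [extendSubst, letterSubst]
  | ih2 z t h1 h2 => rw [map_mul, letters_mul, letters_mul, h1, h2, wordSubst_append]

theorem le_wordExp_of_hasPower {n : ℕ} {t : FreeSemigroup A} (h : HasPower n (letters t)) :
    n ≤ wordExp (toFreeMonoid t) := by
  obtain ⟨p, hp, a, b, h⟩ := h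
  refine (isGreatest_wordExp t).2 ⟨FreeMonoid.ofList a, FreeMonoid.ofList p, FreeMonoid.ofList b,
    hp, FreeMonoid.toList.injective ?_⟩
  have hpow : FreeMonoid.toList (FreeMonoid.ofList p ^ n) = (List.replicate n p).flatten := by
    clear h
    induction n with
    | zero => rfl
    | succ n ih =>
      rw [pow_succ', FreeMonoid.toList_mul, ih, List.replicate_succ, List.flatten_cons]
      rfl
  rw [FreeMonoid.toList_mul, FreeMonoid.toList_mul, hpow]
  exact h.symm

namespace WordEquation

variable (E : WordEquation A X) (μ : FreeSemigroup (A ⊕ X) →ₙ* S)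

/-- The values of the constants in the semigroup with a neutral element adjoined. -/
def constVal (a : A) : WithOne S := μ (FreeSemigroup.of (Sum.inl a))

/-- The equation and its constraint in terms of lists. -/
def toEqState : EqState A X (WithOne S) :=
  ⟨letters E.lhs, letters E.rhs, fun Z => μ (FreeSemigroup.of (Sum.inr Z))⟩

theorem wordVal_letters (t : FreeSemigroup A) :
    wordVal (constVal μ) (letters t) = μ (FreeSemigroup.map Sum.inl t) := by
  induction t using FreeSemigroup.recOnMul with
  | ih1 a => simp [wordVal, constVal]
  | ih2 a t h1 h2 => rw [letters_mul, wordVal_append, h1, h2, map_mul, map_mul, WithOne.coe_mul]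

theorem eq_nil_of_wordVal_eq_one {l : List A} (h : wordVal (constVal μ) l = 1) : l = [] := by
  by_contra hl
  obtain ⟨t, rfl⟩ := exists_letters_eq hl
  rw [wordVal_letters] at h
  exact WithOne.coe_ne_one h

variable {E μ}

theorem letters_mem_sol_iff {σ : X → FreeSemigroup A} :
    (fun Z => letters (σ Z)) ∈ (E.toEqState μ).sol (constVal μ) ↔ σ ∈ E.Sol μ := by
  simp only [EqState.sol, Sol, toEqState, Set.mem_ofPred_eq, ← letters_extendSubst,
    letters_injective.eq_iff, wordVal_letters, WithOne.coe_inj]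

theorem exists_letters_of_mem_sol {σ : X → List A}
    (hσ : σ ∈ (E.toEqState μ).sol (constVal μ)) : ∃ τ ∈ E.Sol μ, σ = fun Z => letters (τ Z) := by
  have : ∀ Z, ∃ t, letters t = σ Z := fun Z => exists_letters_eq fun h => by
    have := hσ.2 Z
    rw [h, wordVal_nil] at this
    exact WithOne.one_ne_coe this
  choose τ hτ using this
  have h : σ = fun Z => letters (τ Z) := funext fun Z => (hτ Z).symm
  exact ⟨τ, letters_mem_sol_iff.1 (h ▸ hσ), h⟩

theorem exp_eq_top_of_unboundedPowers [Fintype X]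
    (h : (E.toEqState μ).UnboundedPowers (constVal μ)) : E.exp μ = ⊤ := by
  refine ENat.eq_top_iff_forall_ge.2 fun n => ?_
  obtain ⟨σ, hσ, Z, hZ⟩ := h n
  obtain ⟨τ, hτ, rfl⟩ := exists_letters_of_mem_sol hσ
  refine le_trans ?_ (le_iSup₂ (f := fun σ (_ : σ ∈ E.Sol μ) => (substExp σ : ℕ∞)) τ hτ)
  exact_mod_cast (le_wordExp_of_hasPower hZ).trans
    (Finset.le_sup (f := fun Z => wordExp (toFreeMonoid (τ Z))) (Finset.mem_univ Z))

theorem infinite_sol_of_exp_eq_top [Fintype X] (h : E.exp μ = ⊤) : (E.Sol μ).Infinite := by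
  intro hfin
  obtain ⟨n, hn⟩ := (hfin.image substExp).bddAbove
  have : E.exp μ ≤ n := iSup₂_le fun σ hσ => by exact_mod_cast hn ⟨σ, hσ, rfl⟩
  rw [h, top_le_iff] at this
  exact ENat.natCast_ne_top n this

theorem exp_eq_top_of_infinite_sol [Finite S] [Finite A] [Fintype X] (hS : IsDLG S ∨ IsDRG S)
    (hE : E.IsQuadratic) (h : (E.Sol μ).Infinite) : E.exp μ = ⊤ := by
  have : Finite (WithOne S) := inferInstanceAs (Finite (Option S))
  let : DecidableEq X := Classical.decEq _
  let : DecidableEq (A ⊕ X) := Classical.decEq _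
  have hcount : ∀ Z, ((E.toEqState μ).lhs ++ (E.toEqState μ).rhs).count (Sum.inr Z) ≤ 2 := by
    intro Z
    have := hE Z
    rw [map_mul, FreeMonoid.toList_mul] at this
    refine le_trans (le_of_eq (List.countP_congr fun z _ => ?_)) this
    simp
  have hinf : ((E.toEqState μ).sol (constVal μ)).Infinite := by
    have hinj : Function.Injective fun (σ : X → FreeSemigroup A) (Z : X) => letters (σ Z) :=
      fun σ τ h => funext fun Z => letters_injective (congrFun h Z)
    refine (h.image hinj.injOn).mono ?_
    rintro _ ⟨σ, hσ, rfl⟩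
    exact letters_mem_sol_iff.2 hσ
  apply exp_eq_top_of_unboundedPowers
  rcases hS with hS | hS
  · exact EqState.unboundedPowers_of_infinite hS.lStabilizing
      (fun _ => eq_nil_of_wordVal_eq_one μ) hcount hinf
  · exact EqState.unboundedPowers_of_infinite_of_op hS.lStabilizing
      (fun _ => eq_nil_of_wordVal_eq_one μ) hcount hinf

end WordEquation

end FreeSemigroups

theorem mainTheorem1 (S : Type u) [Semigroup S] [Finite S] :
    (IsDLG S ↔ RegularDClassesAreRightGroups S) ∧
      (IsDLG S ∨ IsDRG S →
        ∀ (A : Type v) (X : Type w) [Finite A] [Fintype X] (E : WordEquation A X)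
          (μ : FreeSemigroup (A ⊕ X) →ₙ* S),
          E.IsQuadratic → ((E.Sol μ).Infinite ↔ E.exp μ = ⊤)) := by
  exact ⟨isDLG_iff_regularDClassesAreRightGroups, fun hS _ _ _ _ _ _ hE =>
    ⟨WordEquation.exp_eq_top_of_infinite_sol hS hE, WordEquation.infinite_sol_of_exp_eq_top⟩⟩
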